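/- Let $\mathbb{H}^2$ be the hyperbolic plane with distance $d$ and boundary at infinity $\partial_\infty\mathbb{H}^2$, let $\overline{\mathbb{H}^2}=\mathbb{H}^2\cup\partial_\infty\mathbb{H}^2$, and let $G_0=\mathrm{PSL}_2(\mathbb{R})$ be the group of orientation-preserving isometries of $\mathbb{H}^2$, identified with the anti-de Sitter space $\mathrm{AdS}^3$. For a geodesic line $\ell$ of $\mathbb{H}^2$ with closure $\overline{\ell}$ in $\overline{\mathbb{H}^2}$, the *left crooked plane* $\mathsf{C}(\ell)\subset G_0$ is the set of all $h\in G_0$ that have a fixed point in $\overline{\ell}$ which is not the repelling fixed point of a hyperbolic element $h$ (a *nonrepelling* fixed point). A transverse orientation of $\ell$ is the choice of one of the two sides of $\ell$, called positive; $\mathsf{H}_+(\ell)$ is then the set of all $h\in G_0\smallsetminus\{e\}$ with a nonrepelling fixed point in $\overline{\mathbb{H}^2}\smallsetminus\overline{\ell}$ lying on the positive side of $\overline{\ell}$, and $\overline{\mathsf{H}_+(\ell)}$ is its closure in $G_0$. **Theorem 3.1.** Let $\ell,\ell'$ be geodesic lines of $\mathbb{H}^2$ and let $g,g'\in G_0$.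 The following conditions are equivalent: 1. the left crooked planes $g\,\mathsf{C}(\ell)$ and $g'\,\mathsf{C}(\ell')$ are disjoint; 2. there exists $K>0$ such that $d(g\cdot x,g'\cdot x')-d(x,x')\ge K$ for all $x\in\ell$ and $x'\in\ell'$; 3. for any endpoints $\xi$ of $\ell$ and $\xi'$ of $\ell'$ in $\partial_\infty\mathbb{H}^2$, we have $g\cdot\xi\ne g'\cdot\xi'$ and $d(g\cdot\xi,g'\cdot\xi')-d(\xi,\xi')>0$, where this difference denotes the limit in $[-\infty,+\infty]$ of $d(g\cdot x,g'\cdot x')-d(x,x')$ as $(x,x')\in\mathbb{H}^2\times\mathbb{H}^2$ tends to $(\xi,\xi')$ (the limit exists when $g\cdot\xi\neq g'\cdot\xi'$). If these conditions hold, then $g\cdot\ell$ and $g'\cdot\ell'$ have disjoint closures in $\overline{\mathbb{H}^2}$. Moreover, let $\ell$ and $\ell'$ be transversely oriented, and endow $g\cdot\ell$ and $g'\cdot\ell'$ with the transverse orientations induced by $g$ and $g'$. Then $\overline{\mathsf{H}_+(g\cdot\ell)}\,g=g\,\overline{\mathsf{H}_+(\ell)}$ and $\overline{\mathsf{H}_+(g'\cdot\ell')}\,g'=g'\,\overline{\mathsf{H}_+(\ell')}$,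 and the closed half-spaces $g\,\overline{\mathsf{H}_+(\ell)}$ and $g'\,\overline{\mathsf{H}_+(\ell')}$ are disjoint if and only if conditions (1), (2), (3) hold and $g\cdot\ell$ and $g'\cdot\ell'$ are transversely oriented away from each other, i.e. their positive sides in $\mathbb{H}^2$ are disjoint. -/

import Mathlib

open Filter Topology MatrixGroups Pointwise

/-- The group `G₀ = PSL₂(ℝ)` of orientation-preserving isometries of the hyperbolic plane,
with its quotient topology.  It is also the model of anti-de Sitter space `AdS³`. -/
abbrev G0 : Type := Matrix.ProjectiveSpecialLinearGroup (Fin 2) ℝ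

namespace G0

theorem center_eq {A : SL(2, ℝ)} (hA : A ∈ Subgroup.center SL(2, ℝ)) : A = 1 ∨ A = -1 := by
  obtain ⟨r, hr, h⟩ := Matrix.SpecialLinearGroup.mem_center_iff.mp hA
  have hr' : r = 1 ∨ r = -1 := by simpa using hr
  rcases hr' with rfl | rfl
  · left; apply Subtype.ext; rw [← h]; simp
  · right; apply Subtype.ext; rw [← h]; ext i j; fin_cases i <;> fin_cases j <;> simp

/-- The action of `G₀` by isometries on the upper half-plane `ℍ`, as permutations. -/
noncomputable def toPermPlane : G0 →* Equiv.Perm UpperHalfPlane :=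
  QuotientGroup.lift _ (MulAction.toPermHom SL(2, ℝ) UpperHalfPlane) (by
    intro A hA
    rcases center_eq hA with rfl | rfl
    · simp
    · ext z : 2
      simp [UpperHalfPlane.coe_specialLinearGroup_apply])

/-- The action of `G₀` by Möbius transformations on the Riemann sphere `ℂ ∪ {∞}`,
as permutations. -/
noncomputable def toPermSphere : G0 →* Equiv.Perm (OnePoint ℂ) :=
  QuotientGroup.lift _ ((MulAction.toPermHom (GL (Fin 2) ℂ) (OnePoint ℂ)).comp
      (Matrix.SpecialLinearGroup.toGL.comp
        (Matrix.SpecialLinearGroup.map (algebraMap ℝ ℂ)))) (by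
    intro A hA
    rcases center_eq hA with rfl | rfl
    · simp
    · ext x
      induction x using OnePoint.rec with
      | infty => simp [OnePoint.smul_infty_eq_ite]
      | coe z => simp [OnePoint.smul_some_eq_ite])

noncomputable instance : MulAction G0 UpperHalfPlane :=
  MulAction.compHom UpperHalfPlane toPermPlane

noncomputable instance : MulAction G0 (OnePoint ℂ) :=
  MulAction.compHom (OnePoint ℂ) toPermSphere

end G0

namespace HypPlane

/-- The inclusion of the hyperbolic plane `ℍ` (with Mathlib's hyperbolic distance `dist`) into the
Riemann sphere.  The closure of its range is `ℍ ∪ ℝ ∪ {∞}`, the usual compactification of the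
hyperbolic plane by its boundary at infinity `ℝ ∪ {∞}`. -/
def toSphere (z : UpperHalfPlane) : OnePoint ℂ := ((z : ℂ) : OnePoint ℂ)

/-- The closure, in the compactification of the hyperbolic plane, of a subset of the plane. -/
def bar (s : Set UpperHalfPlane) : Set (OnePoint ℂ) := closure (toSphere '' s)

/-- The boundary at infinity of the hyperbolic plane. -/
def boundary : Set (OnePoint ℂ) := bar Set.univ \ Set.range toSphere

/-- A geodesic line: the image of an isometric embedding of `ℝ`. -/
def IsGeodesicLine (l : Set UpperHalfPlane) : Prop :=
  ∃ γ : ℝ → UpperHalfPlane, Isometry γ ∧ Set.range γ = l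

/-- The endpoints at infinity of a geodesic line. -/
def endpoints (l : Set UpperHalfPlane) : Set (OnePoint ℂ) := bar l ∩ boundary

/-- `P` is one of the two sides of the geodesic line `l`, that is, a connected component of its
complement.  A transverse orientation of `l` is the choice of such a side, the positive one. -/
def IsSide (l P : Set UpperHalfPlane) : Prop :=
  ∃ z ∈ lᶜ, P = connectedComponentIn lᶜ z

/-- The difference `d(g⬝x, g'⬝x') - d(x,x')` for points `x`, `x'` of the hyperbolic plane. -/
noncomputable def distDiff (g g' : G0) (p : UpperHalfPlane × UpperHalfPlane) : ℝ :=
  dist (g • p.1) (g' • p.2) - dist p.1 p.2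

/-- `L ∈ [-∞, ∞]` is the value at the pair `(ξ, ξ')` of the continuous extension of
`d(g⬝x, g'⬝x') - d(x,x')` to the compactification: the limit of this difference as the points
`x`, `x'` of the hyperbolic plane tend to `ξ`, `ξ'`. -/
def ExtDistDiff (g g' : G0) (ξ ξ' : OnePoint ℂ) (L : EReal) : Prop :=
  Tendsto (fun p => (distDiff g g' p : EReal))
    (comap (Prod.map toSphere toSphere) (𝓝 (ξ, ξ'))) (𝓝 L)

end HypPlane

namespace AdS

open HypPlane

/-- `h ∈ PSL₂(ℝ)` is hyperbolic if its lifts to `SL₂(ℝ)` are (`|trace| > 2`). -/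
def IsHyperbolic (h : G0) : Prop :=
  ∃ A : SL(2, ℝ), QuotientGroup.mk A = h ∧ (A : Matrix (Fin 2) (Fin 2) ℝ).IsHyperbolic

/-- `ξ` is the repelling fixed point of the hyperbolic element `h`: all backward orbits in the
hyperbolic plane converge to `ξ`. -/
def IsRepelling (h : G0) (ξ : OnePoint ℂ) : Prop :=
  IsHyperbolic h ∧
    ∀ z : UpperHalfPlane, Tendsto (fun n : ℕ => toSphere (h⁻¹ ^ n • z)) atTop (𝓝 ξ)

/-- `x` is a fixed point of `h` which is not repelling. -/
def IsNonrepellingFixed (h : G0) (x : OnePoint ℂ) : Prop :=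
  h • x = x ∧ ¬ IsRepelling h x

/-- The left crooked plane centred at the identity associated with the geodesic line `l`. -/
def crookedPlane (l : Set UpperHalfPlane) : Set G0 :=
  {h | ∃ x ∈ bar l, IsNonrepellingFixed h x}

/-- The open left crooked half-space centred at the identity associated with the geodesic line `l`
with positive side `P`: the nontrivial elements with a nonrepelling fixed point, in the
compactification minus the closure of `l`, on the positive side. -/
def halfSpace (l P : Set UpperHalfPlane) : Set G0 :=
  {h | h ≠ 1 ∧ ∃ x ∈ bar P \ bar l, IsNonrepellingFixed h x}

/-- The closed left crooked half-space: the closure in `AdS³ = PSL₂(ℝ)`. -/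
def closedHalfSpace (l P : Set UpperHalfPlane) : Set G0 := closure (halfSpace l P)

end AdS

/-! Every line is the image of the imaginary axis under an isometry, so put `l = k • axis`, `l' = k'
• axis`, and lift `(g' k')⁻¹ (g k)` and `k'⁻¹ k` to matrices `B₁` and `B₀`. Each of the three
conditions turns out to be equivalent to `Dominates B₁ B₀`: every entry of `B₁` exceeds the
corresponding entry of `B₀` in absolute value.

Distances: if `B` has rows `(a, b)` and `(c, d)`, then `2 cosh d(B · ie^s, ie^t) = a² X + d² / X +
c² Y + b² / Y` with `X = e^(s-t)` and `Y = e^(s+t)` independent positive variables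
(`two_cosh_dist_axisPt`). A uniform gap of distances is a uniform ratio of such forms, hence strict
domination of the coefficients. At the endpoints `(∞, ∞)` the difference of distances tends to `2
log (|c₁| / |c₀|)` (`corner_lt_iff`); the half-turn about `i`, which swaps `0` and `∞`, moves each
of the other entries to the lower left corner.

Crooked planes: they meet exactly when `B₁ h = h' B₀` for some `h`, `h'` in the crooked plane of the
axis. A nonrepelling fixed point gives a symmetric matrix `S` with `A S Aᵀ = κ S`, `κ ≥ 1`, and `S`
is diagonal for fixed points on the closed axis. Pairing two such matrices by the polarized
determinant turns `B₁ h = h' B₀` into an identity between nonnegative combinations of squared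
entries, which domination forbids. Conversely, if domination fails, a solution is produced either by
explicit triangular matrices fixing `∞` or by two rotations about points `x`, `y` of the axis with
`d(B₁ x, y) = d(B₀ x, y)`.

Half-spaces: their elements give matrices `S` with nonnegative off-diagonal entry. Disjointness of
the positive sides fixes the signs of the products of entries of `B₁`, so that the new cross terms
are dominated too. If the sides meet, the intermediate value theorem again yields points of the
positive sides at equal distances, hence intertwined rotations. -/

namespace G0

/-- The projection from `SL(2, ℝ)` to `G0`. -/
noncomputable def mk : SL(2, ℝ) →* G0 := QuotientGroup.mk' _

theorem mk_surjective : Function.Surjective mk := QuotientGroup.mk'_surjective _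

theorem det_entries (A : SL(2, ℝ)) : A 0 0 * A 1 1 - A 0 1 * A 1 0 = 1 := by
  have := A.det_coe
  rwa [Matrix.det_fin_two] at this

@[simp]
theorem mul_entry (A B : SL(2, ℝ)) (i j : Fin 2) :
    (A * B) i j = A i 0 * B 0 j + A i 1 * B 1 j := by
  change (A.1 * B.1) i j = _
  rw [Matrix.mul_apply, Fin.sum_univ_two]

theorem inv_entries (A : SL(2, ℝ)) :
    A⁻¹ 0 0 = A 1 1 ∧ A⁻¹ 0 1 = - A 0 1 ∧ A⁻¹ 1 0 = - A 1 0 ∧ A⁻¹ 1 1 = A 0 0 := by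
  rw [Matrix.SpecialLinearGroup.SL2_inv_expl]
  exact ⟨rfl, rfl, rfl, rfl⟩

@[simp] theorem inv_entry_00 (A : SL(2, ℝ)) : A⁻¹ 0 0 = A 1 1 := (inv_entries A).1

@[simp] theorem inv_entry_01 (A : SL(2, ℝ)) : A⁻¹ 0 1 = - A 0 1 := (inv_entries A).2.1

@[simp] theorem inv_entry_10 (A : SL(2, ℝ)) : A⁻¹ 1 0 = - A 1 0 := (inv_entries A).2.2.1

@[simp] theorem inv_entry_11 (A : SL(2, ℝ)) : A⁻¹ 1 1 = A 0 0 := (inv_entries A).2.2.2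

/-- The element of `SL(2, ℝ)` with the given entries. -/
def ofEntries (a b c d : ℝ) (h : a * d - b * c = 1) : SL(2, ℝ) :=
  ⟨!![a, b; c, d], by rw [Matrix.det_fin_two]; exact h⟩

section

variable (a b c d : ℝ) (h : a * d - b * c = 1)

@[simp] theorem ofEntries_00 : ofEntries a b c d h 0 0 = a := rfl

@[simp] theorem ofEntries_01 : ofEntries a b c d h 0 1 = b := rfl

@[simp] theorem ofEntries_10 : ofEntries a b c d h 1 0 = c := rfl

@[simp] theorem ofEntries_11 : ofEntries a b c d h 1 1 = d := rfl

end

theorem ext_entries {A B : SL(2, ℝ)} (h00 : A 0 0 = B 0 0) (h01 : A 0 1 = B 0 1)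
    (h10 : A 1 0 = B 1 0) (h11 : A 1 1 = B 1 1) : A = B := by
  ext i j
  fin_cases i <;> fin_cases j <;> assumption

/-! ### Möbius action on the plane and on the sphere -/

theorem mk_smul_plane (A : SL(2, ℝ)) (z : UpperHalfPlane) : mk A • z = A • z := rfl

theorem mk_smul_coe (A : SL(2, ℝ)) (z : ℂ) : mk A • (z : OnePoint ℂ) =
    if (A 1 0 : ℂ) * z + A 1 1 = 0 then OnePoint.infty
    else (((A 0 0 * z + A 0 1) / (A 1 0 * z + A 1 1) : ℂ) : OnePoint ℂ) := by
  refine (OnePoint.smul_some_eq_ite (g := Matrix.SpecialLinearGroup.toGL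
        (Matrix.SpecialLinearGroup.map (algebraMap ℝ ℂ) A)) (k := z)).trans ?_
  simp

theorem mk_smul_infty (A : SL(2, ℝ)) : mk A • (OnePoint.infty : OnePoint ℂ) =
    if A 1 0 = 0 then OnePoint.infty
    else (((A 0 0 : ℂ) / A 1 0 : ℂ) : OnePoint ℂ) := by
  refine (OnePoint.smul_infty_eq_ite (Matrix.SpecialLinearGroup.toGL
        (Matrix.SpecialLinearGroup.map (algebraMap ℝ ℂ) A))).trans ?_
  simp

theorem denom_ne_zero (A : SL(2, ℝ)) (z : UpperHalfPlane) : (A 1 0 : ℂ) * z + A 1 1 ≠ 0 :=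
  UpperHalfPlane.denom_ne_zero (A : GL (Fin 2) ℝ) z

theorem coe_mk_smul (A : SL(2, ℝ)) (z : UpperHalfPlane) :
    ((mk A • z : UpperHalfPlane) : ℂ) = (A 0 0 * z + A 0 1) / (A 1 0 * z + A 1 1) := by
  rw [mk_smul_plane, UpperHalfPlane.coe_specialLinearGroup_apply]
  simp

theorem im_mk_smul (A : SL(2, ℝ)) (z : UpperHalfPlane) :
    (mk A • z : UpperHalfPlane).im = z.im / Complex.normSq (A 1 0 * z + A 1 1) := by
  rw [← UpperHalfPlane.coe_im, coe_mk_smul, Complex.div_im]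
  have hdet := det_entries A
  simp only [Complex.add_re, Complex.add_im, Complex.mul_re, Complex.mul_im, Complex.ofReal_re,
    Complex.ofReal_im, UpperHalfPlane.coe_re, UpperHalfPlane.coe_im]
  rw [← sub_div]
  congr 1
  linear_combination z.im * hdet

theorem toSphere_smul (g : G0) (z : UpperHalfPlane) :
    HypPlane.toSphere (g • z) = g • HypPlane.toSphere z := by
  obtain ⟨A, rfl⟩ := mk_surjective g
  simp only [HypPlane.toSphere]
  rw [mk_smul_coe, if_neg (denom_ne_zero A z), coe_mk_smul]

instance : IsIsometricSMul G0 UpperHalfPlane where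
  isometry_smul g := by
    obtain ⟨A, rfl⟩ := mk_surjective g
    exact isometry_smul UpperHalfPlane A

theorem tendsto_coe_infty {α : Type*} {F : Filter α} {f : α → ℂ}
    (h : Tendsto (fun x => ‖f x‖) F atTop) :
    Tendsto (fun x => (f x : OnePoint ℂ)) F (𝓝 OnePoint.infty) := by
  refine OnePoint.tendsto_coe_infty.comp ?_
  rw [coclosedCompact_eq_cocompact, ← Metric.cobounded_eq_cocompact]
  exact tendsto_norm_atTop_iff_cobounded.mp h

instance : ContinuousConstSMul G0 (OnePoint ℂ) where
  continuous_const_smul g := by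
    obtain ⟨A, rfl⟩ := mk_surjective g
    have hdet : (A 0 0 : ℂ) * A 1 1 - A 0 1 * A 1 0 = 1 := by exact_mod_cast det_entries A
    rw [continuous_iff_continuousAt]
    intro x
    induction x using OnePoint.rec with
    | infty =>
      rw [OnePoint.continuousAt_infty', mk_smul_infty]
      rw [coclosedCompact_eq_cocompact]
      have key : ∀ᶠ z : ℂ in cocompact ℂ, z ≠ 0 := by
        have := tendsto_norm_cocompact_atTop (E := ℂ)
        filter_upwards [this.eventually_gt_atTop 0] with z hz
        exact norm_pos_iff.mp hz
      have hinv : Tendsto (fun z : ℂ => z⁻¹) (cocompact ℂ) (𝓝 0) := by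
        rw [← Metric.cobounded_eq_cocompact]; exact tendsto_inv₀_cobounded
      split_ifs with hc
      · have hd : (A 1 1 : ℂ) ≠ 0 := by
          intro h0; simp [hc, h0] at hdet
        have ha : (A 0 0 : ℂ) ≠ 0 := by
          intro h0; simp [hc, h0] at hdet
        have : (fun z : ℂ => mk A • (z : OnePoint ℂ)) =
            fun z : ℂ => (((A 0 0 * z + A 0 1) / A 1 1 : ℂ) : OnePoint ℂ) := by
          ext z; rw [mk_smul_coe]; simp [hc, hd]
        change Tendsto (fun z : ℂ => mk A • (z : OnePoint ℂ)) _ _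
        rw [this]
        apply tendsto_coe_infty
        have h1 : Tendsto (fun z : ℂ => ‖(A 0 0 : ℂ) * z‖) (cocompact ℂ) atTop := by
          simp only [norm_mul]
          exact (tendsto_norm_cocompact_atTop (E := ℂ)).const_mul_atTop (norm_pos_iff.mpr ha)
        have h2 : Tendsto (fun z : ℂ => (‖(A 0 0 : ℂ) * z‖ + - ‖(A 0 1 : ℂ)‖) / ‖(A 1 1 : ℂ)‖)
            (cocompact ℂ) atTop :=
          (tendsto_atTop_add_const_right _ _ h1).atTop_div_const (norm_pos_iff.mpr hd)
        refine tendsto_atTop_mono (fun z => ?_) h2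
        rw [norm_div]
        gcongr
        have := norm_sub_le ((A 0 0 : ℂ) * z + A 0 1) (A 0 1)
        simp only [add_sub_cancel_right] at this
        linarith
      · have hc' : (A 1 0 : ℂ) ≠ 0 := by exact_mod_cast hc
        have h1 : Tendsto (fun z : ℂ => (A 0 0 + A 0 1 * z⁻¹) / (A 1 0 + A 1 1 * z⁻¹))
            (cocompact ℂ) (𝓝 ((A 0 0 + A 0 1 * 0) / (A 1 0 + A 1 1 * 0))) :=
          (tendsto_const_nhds.add (hinv.const_mul _)).div
            (tendsto_const_nhds.add (hinv.const_mul _)) (by simpa using hc')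
        have h2 : ∀ᶠ z : ℂ in cocompact ℂ, (A 1 0 : ℂ) + A 1 1 * z⁻¹ ≠ 0 := by
          have : Tendsto (fun z : ℂ => (A 1 0 : ℂ) + A 1 1 * z⁻¹) (cocompact ℂ)
            (𝓝 (A 1 0 + A 1 1 * 0)) := tendsto_const_nhds.add (hinv.const_mul _)
          exact this.eventually_ne (by simpa using hc')
        have h3 := (OnePoint.continuous_coe.tendsto _).comp h1
        simp only [mul_zero, add_zero] at h3
        refine h3.congr' ?_
        filter_upwards [key, h2] with z hz hz2
        have e : (A 1 0 : ℂ) * z + A 1 1 = z * (A 1 0 + A 1 1 * z⁻¹) := by field_simp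
        simp only [Function.comp]
        rw [mk_smul_coe, if_neg (by rw [e]; exact mul_ne_zero hz hz2), e]
        congr 1
        field_simp
    | coe z =>
      rw [OnePoint.continuousAt_coe]
      have hcont : Tendsto (fun w : ℂ => (A 1 0 : ℂ) * w + A 1 1) (𝓝 z) (𝓝 (A 1 0 * z + A 1 1)) :=
        Continuous.tendsto (by fun_prop) z
      have hcont0 : Tendsto (fun w : ℂ => (A 0 0 : ℂ) * w + A 0 1) (𝓝 z) (𝓝 (A 0 0 * z + A 0 1)) :=
        Continuous.tendsto (by fun_prop) z
      by_cases h0 : (A 1 0 : ℂ) * z + A 1 1 = 0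
      -- At a pole the numerator cannot vanish as well, since the determinant is 1; the reciprocal
      -- of the image therefore tends to 0.
      · have hn : (A 0 0 : ℂ) * z + A 0 1 ≠ 0 := by
          intro h1
          have : (A 0 0 : ℂ) * (A 1 0 * z + A 1 1) - A 1 0 * (A 0 0 * z + A 0 1) = 0 := by
            rw [h0, h1]; ring
          rw [show (A 0 0 : ℂ) * (A 1 0 * z + A 1 1) - A 1 0 * (A 0 0 * z + A 0 1) =
            A 0 0 * A 1 1 - A 0 1 * A 1 0 by ring, hdet] at this
          exact one_ne_zero this
        simp only [ContinuousAt, Function.comp_def]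
        rw [mk_smul_coe A z, if_pos h0]
        have h1 : Tendsto (fun w : ℂ => ‖((A 1 0 : ℂ) * w + A 1 1) / (A 0 0 * w + A 0 1)‖)
            (𝓝 z) (𝓝 0) := by
          have := (hcont.div hcont0 hn).norm
          simpa [h0] using this
        rw [OnePoint.hasBasis_nhds_infty.tendsto_right_iff]
        rintro s ⟨-, hs⟩
        obtain ⟨R, hR⟩ := hs.isBounded.exists_norm_le
        have h2 := h1.eventually_lt_const (show (0 : ℝ) < (|R| + 1)⁻¹ by positivity)
        have h3 := hcont0.eventually_ne hn
        filter_upwards [h2, h3] with w hw hw3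
        rw [mk_smul_coe]
        split_ifs with hw0
        · right; rfl
        · left
          refine ⟨_, fun hmem => ?_, rfl⟩
          have h4 := hR _ hmem
          rw [norm_div] at h4 hw
          have p1 := norm_pos_iff.mpr hw0
          have p3 := norm_pos_iff.mpr hw3
          rw [div_le_iff₀ p1] at h4
          rw [inv_eq_one_div, div_lt_div_iff₀ p3 (by positivity)] at hw
          nlinarith [le_abs_self R]
      · simp only [ContinuousAt, Function.comp_def]
        rw [mk_smul_coe A z, if_neg h0]
        refine ((OnePoint.continuous_coe.tendsto _).comp (hcont0.div hcont h0)).congr' ?_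
        filter_upwards [hcont.eventually_ne h0] with w hw
        rw [mk_smul_coe, if_neg hw]
        rfl

instance : IsTopologicalGroup G0 :=
  inferInstanceAs (IsTopologicalGroup (SL(2, ℝ) ⧸ Subgroup.center SL(2, ℝ)))

theorem isOpenQuotientMap_mk : IsOpenQuotientMap mk := QuotientGroup.isOpenQuotientMap_mk

theorem mk_eq_mk_iff {A B : SL(2, ℝ)} : mk A = mk B ↔ A = B ∨ A = -B := by
  constructor
  · intro h
    have := QuotientGroup.eq.mp h
    rcases center_eq this with h | h
    · left; exact (inv_mul_eq_one.mp h)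
    · right
      rw [inv_mul_eq_iff_eq_mul] at h
      simp [h]
  · rintro (rfl | rfl)
    · rfl
    · refine QuotientGroup.eq.mpr ?_
      rw [Matrix.SpecialLinearGroup.mem_center_iff]
      refine ⟨-1, by simp, ?_⟩
      have : (-B)⁻¹ * B = -1 := by
        rw [inv_mul_eq_iff_eq_mul]; simp
      rw [this]
      ext i j
      fin_cases i <;> fin_cases j <;> simp

end G0

/-! ### Equivariance of closures, endpoints, crooked planes and half-spaces -/

namespace HypPlane

open G0

theorem bar_smul (g : G0) (s : Set UpperHalfPlane) : bar (g • s) = g • bar s := by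
  unfold bar
  rw [← closure_smul]
  congr 1
  ext x
  simp only [Set.mem_image, Set.mem_smul_set]
  constructor
  · rintro ⟨_, ⟨y, hy, rfl⟩, rfl⟩
    exact ⟨_, ⟨y, hy, rfl⟩, (toSphere_smul g y).symm⟩
  · rintro ⟨_, ⟨y, hy, rfl⟩, rfl⟩
    exact ⟨_, ⟨y, hy, rfl⟩, (toSphere_smul g y)⟩

theorem smul_range_toSphere (g : G0) : g • Set.range toSphere = Set.range toSphere := by
  ext x
  simp only [Set.mem_smul_set, Set.mem_range, exists_exists_eq_and]
  constructor
  · rintro ⟨y, rfl⟩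
    exact ⟨g • y, toSphere_smul g y⟩
  · rintro ⟨y, rfl⟩
    exact ⟨g⁻¹ • y, by rw [← toSphere_smul, smul_inv_smul]⟩

theorem smul_boundary (g : G0) : g • boundary = boundary := by
  unfold boundary
  rw [Set.smul_set_sdiff, smul_range_toSphere, ← bar_smul, Set.smul_set_univ]

theorem endpoints_smul (g : G0) (l : Set UpperHalfPlane) :
    endpoints (g • l) = g • endpoints l := by
  unfold endpoints
  rw [Set.smul_set_inter, smul_boundary, bar_smul]

end HypPlane

namespace AdS

open HypPlane G0

theorem isHyperbolic_mk_iff (A : SL(2, ℝ)) :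
    IsHyperbolic (mk A) ↔ 4 < (A 0 0 + A 1 1) ^ 2 := by
  have key : ∀ B : SL(2, ℝ), (B : Matrix (Fin 2) (Fin 2) ℝ).IsHyperbolic ↔
      4 < (B 0 0 + B 1 1) ^ 2 := by
    intro B
    rw [Matrix.IsHyperbolic, Matrix.discr_fin_two, B.det_coe, Matrix.trace_fin_two]
    constructor <;> intro h <;> linarith
  constructor
  · rintro ⟨B, hB, h⟩
    rw [key] at h
    rcases mk_eq_mk_iff.mp hB with rfl | rfl
    · exact h
    · simp at h; linarith
  · exact fun h => ⟨A, rfl, (key A).mpr h⟩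

theorem IsHyperbolic.conj {h : G0} (hh : IsHyperbolic h) (g : G0) :
    IsHyperbolic (g * h * g⁻¹) := by
  obtain ⟨A, rfl, hA⟩ := hh
  obtain ⟨B, rfl⟩ := mk_surjective g
  refine ⟨B * A * B⁻¹, rfl, ?_⟩
  have := (Matrix.isHyperbolic_conj_iff (m := (A : Matrix (Fin 2) (Fin 2) ℝ)) (B : GL (Fin 2) ℝ)).mpr hA
  convert this using 1
  rw [← Matrix.coe_units_inv, ← map_inv]
  rfl

theorem IsRepelling.conj {h : G0} {x : OnePoint ℂ} (hh : IsRepelling h x) (g : G0) :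
    IsRepelling (g * h * g⁻¹) (g • x) := by
  refine ⟨hh.1.conj g, fun z => ?_⟩
  have := (hh.2 (g⁻¹ • z)).const_smul g
  refine this.congr fun n => ?_
  rw [← toSphere_smul, show (g * h * g⁻¹)⁻¹ = g * h⁻¹ * g⁻¹ by group, conj_pow, mul_smul, mul_smul]

theorem isRepelling_conj_iff {h : G0} {x : OnePoint ℂ} (g : G0) :
    IsRepelling (g * h * g⁻¹) (g • x) ↔ IsRepelling h x := by
  refine ⟨fun H => ?_, fun H => H.conj g⟩
  have := H.conj g⁻¹
  rwa [inv_smul_smul, show g⁻¹ * (g * h * g⁻¹) * g⁻¹⁻¹ = h by group] at this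

theorem isNonrepellingFixed_conj_iff {h : G0} {x : OnePoint ℂ} (g : G0) :
    IsNonrepellingFixed (g * h * g⁻¹) (g • x) ↔ IsNonrepellingFixed h x := by
  unfold IsNonrepellingFixed
  rw [isRepelling_conj_iff, mul_smul, mul_smul, inv_smul_smul, smul_left_cancel_iff]

theorem crookedPlane_smul (g : G0) (l : Set UpperHalfPlane) (h : G0) :
    g * h * g⁻¹ ∈ crookedPlane (g • l) ↔ h ∈ crookedPlane l := by
  unfold crookedPlane
  simp only [bar_smul, Set.mem_ofPred_eq]
  constructor
  · rintro ⟨_, ⟨x, hx, rfl⟩, H⟩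
    exact ⟨x, hx, (isNonrepellingFixed_conj_iff g).mp H⟩
  · rintro ⟨x, hx, H⟩
    exact ⟨g • x, Set.smul_mem_smul_set hx, (isNonrepellingFixed_conj_iff g).mpr H⟩

theorem halfSpace_smul (g : G0) (l P : Set UpperHalfPlane) (h : G0) :
    g * h * g⁻¹ ∈ halfSpace (g • l) (g • P) ↔ h ∈ halfSpace l P := by
  unfold halfSpace
  simp only [bar_smul, Set.mem_ofPred_eq, ← Set.smul_set_sdiff]
  refine and_congr (by simp) ?_
  constructor
  · rintro ⟨_, ⟨x, hx, rfl⟩, H⟩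
    exact ⟨x, hx, (isNonrepellingFixed_conj_iff g).mp H⟩
  · rintro ⟨x, hx, H⟩
    exact ⟨g • x, Set.smul_mem_smul_set hx, (isNonrepellingFixed_conj_iff g).mpr H⟩

/-- Conjugation by `g`, as a self-homeomorphism of `G0`. -/
noncomputable def conjHomeo (g : G0) : G0 ≃ₜ G0 :=
  (Homeomorph.mulLeft g).trans (Homeomorph.mulRight g⁻¹)

theorem conjHomeo_apply (g h : G0) : conjHomeo g h = g * h * g⁻¹ := rfl

theorem closedHalfSpace_smul_eq (g : G0) (l P : Set UpperHalfPlane) :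
    closedHalfSpace (g • l) (g • P) = conjHomeo g '' closedHalfSpace l P := by
  unfold closedHalfSpace
  rw [(conjHomeo g).image_closure]
  congr 1
  ext h
  constructor
  · intro H
    refine ⟨g⁻¹ * h * g, ?_, by rw [conjHomeo_apply]; group⟩
    rw [← halfSpace_smul g]
    convert H using 1
    group
  · rintro ⟨h, H, rfl⟩
    exact (halfSpace_smul g l P h).mpr H

theorem closedHalfSpace_smul (g : G0) (l P : Set UpperHalfPlane) (h : G0) :
    g * h * g⁻¹ ∈ closedHalfSpace (g • l) (g • P) ↔ h ∈ closedHalfSpace l P := by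
  rw [closedHalfSpace_smul_eq, ← conjHomeo_apply, (conjHomeo g).injective.mem_set_image]

/-- Moving a half-space by `g` conjugates it, and right multiplication by `g` cancels the factor
`g⁻¹` of the conjugation. -/
theorem image_mul_right_closedHalfSpace_smul (g : G0) (l P : Set UpperHalfPlane) :
    (fun h => h * g) '' closedHalfSpace (g • l) (g • P) = g • closedHalfSpace l P := by
  rw [closedHalfSpace_smul_eq, Set.image_image, ← Set.image_smul]
  refine Set.image_congr fun h _ => ?_
  rw [conjHomeo_apply]
  simp

/-! ### Nonrepelling fixed points in terms of matrices -/

theorem im_inv_pow_smul (A : SL(2, ℝ)) (hc : A 1 0 = 0) (z : UpperHalfPlane) (n : ℕ) :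
    ((mk A)⁻¹ ^ n • z).im = z.im * ((A 0 0 ^ 2)⁻¹) ^ n := by
  induction n with
  | zero => simp
  | succ n ih =>
    rw [pow_succ', mul_smul, ← map_inv, im_mk_smul, map_inv, ih]
    rw [inv_entry_10, inv_entry_11, hc, neg_zero, Complex.ofReal_zero, zero_mul, zero_add,
      Complex.normSq_ofReal, ← sq, div_eq_mul_inv, mul_assoc, ← pow_succ]

theorem isRepelling_infty (A : SL(2, ℝ)) (hc : A 1 0 = 0) (ha : |A 0 0| < 1) :
    IsRepelling (mk A) OnePoint.infty := by
  have hdet := det_entries A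
  rw [hc, mul_zero, sub_zero] at hdet
  have ha0 : A 0 0 ≠ 0 := left_ne_zero_of_mul_eq_one hdet
  have ha2 : A 0 0 ^ 2 < 1 := (sq_lt_one_iff_abs_lt_one _).mpr ha
  have hap : 0 < A 0 0 ^ 2 := by positivity
  refine ⟨?_, fun z => ?_⟩
  · rw [isHyperbolic_mk_iff]
    have h1 : A 0 0 ≠ A 1 1 := fun h => by rw [← h] at hdet; nlinarith
    have h2 : 0 < (A 0 0 - A 1 1) ^ 2 := by
      have := sub_ne_zero.mpr h1
      positivity
    nlinarith
  · apply tendsto_coe_infty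
    have h1 : Tendsto (fun n : ℕ => z.im * ((A 0 0 ^ 2)⁻¹) ^ n) atTop atTop :=
      (tendsto_pow_atTop_atTop_of_one_lt ((one_lt_inv₀ hap).mpr ha2)).const_mul_atTop z.im_pos
    refine tendsto_atTop_mono (fun n => ?_) h1
    rw [← im_inv_pow_smul A hc z n]
    exact (le_abs_self _).trans (Complex.abs_im_le_norm _)

/-- An element of `SL(2, ℝ)` sending `∞` to the real number `x`. -/
def inftyTo (x : ℝ) : SL(2, ℝ) := ofEntries x (-1) 1 0 (by norm_num)

theorem mk_inftyTo_smul (x : ℝ) :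
    mk (inftyTo x) • (OnePoint.infty : OnePoint ℂ) = ((x : ℂ) : OnePoint ℂ) := by
  rw [mk_smul_infty]
  simp [inftyTo]

/-- Conjugation carries a real fixed point `x` to `∞`: the lower left entry then expresses the fixed
point equation, and the upper left entry is the factor `c x + d`. -/
theorem inftyTo_conj (A : SL(2, ℝ)) (x : ℝ) :
    ((inftyTo x)⁻¹ * A * inftyTo x) 1 0 = x * (A 1 0 * x + A 1 1) - (A 0 0 * x + A 0 1) ∧
    ((inftyTo x)⁻¹ * A * inftyTo x) 0 0 = A 1 0 * x + A 1 1 := by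
  constructor <;> simp [inftyTo]
  ring

theorem isRepelling_ofReal_iff (A : SL(2, ℝ)) (x : ℝ) :
    IsRepelling (mk A) ((x : ℂ) : OnePoint ℂ) ↔
      IsRepelling (mk ((inftyTo x)⁻¹ * A * inftyTo x)) OnePoint.infty := by
  rw [← isRepelling_conj_iff (h := mk ((inftyTo x)⁻¹ * A * inftyTo x)) (mk (inftyTo x)),
    mk_inftyTo_smul, ← map_inv, ← map_mul, ← map_mul]
  group

/-- If `∞` were repelling, `h` would be hyperbolic, hence `|d| < 1`, and its other fixed point `b /
(d - a)` would be repelling as well. Backward orbits would have two limits. -/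
theorem not_isRepelling_infty (A : SL(2, ℝ)) (hc : A 1 0 = 0) (ha : 1 ≤ |A 0 0|) :
    ¬ IsRepelling (mk A) OnePoint.infty := by
  intro H
  have hdet := det_entries A
  rw [hc, mul_zero, sub_zero] at hdet
  have hyp := (isHyperbolic_mk_iff A).mp H.1
  have hne : A 1 1 - A 0 0 ≠ 0 := by
    intro h
    have : A 1 1 = A 0 0 := by linarith
    rw [this] at hdet hyp
    nlinarith
  have hd : |A 1 1| < 1 := by
    have h1 : |A 0 0| * |A 1 1| = 1 := by rw [← abs_mul, hdet, abs_one]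
    rcases ha.eq_or_lt with h | h
    · rw [← h, one_mul] at h1
      rcases eq_or_eq_neg_of_abs_eq h.symm with h2 | h2 <;>
      rcases eq_or_eq_neg_of_abs_eq h1 with h3 | h3 <;>
      rw [h2, h3] at hyp <;> norm_num at hyp
    · nlinarith [abs_nonneg (A 1 1)]
  obtain ⟨h1, h2⟩ := inftyTo_conj A (A 0 1 / (A 1 1 - A 0 0))
  rw [hc] at h1 h2
  have h3 := isRepelling_infty ((inftyTo (A 0 1 / (A 1 1 - A 0 0)))⁻¹ * A *
    inftyTo (A 0 1 / (A 1 1 - A 0 0))) (by rw [h1]; field_simp; ring) (by rw [h2]; simpa using hd)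
  rw [← isRepelling_ofReal_iff] at h3
  exact OnePoint.coe_ne_infty _ (tendsto_nhds_unique (h3.2 UpperHalfPlane.I) (H.2 UpperHalfPlane.I))

theorem isNonrepellingFixed_infty_iff (A : SL(2, ℝ)) :
    IsNonrepellingFixed (mk A) OnePoint.infty ↔ A 1 0 = 0 ∧ 1 ≤ |A 0 0| := by
  unfold IsNonrepellingFixed
  have hfix : mk A • (OnePoint.infty : OnePoint ℂ) = OnePoint.infty ↔ A 1 0 = 0 := by
    rw [mk_smul_infty]
    split_ifs with h <;> simp [h]
  rw [hfix]
  refine and_congr_right fun hc => ⟨fun h => ?_, not_isRepelling_infty A hc⟩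
  by_contra! h'
  exact h (isRepelling_infty A hc h')

theorem smul_coe_eq_self_iff (A : SL(2, ℝ)) (z : ℂ) :
    mk A • (z : OnePoint ℂ) = z ↔ (A 0 0 : ℂ) * z + A 0 1 = z * (A 1 0 * z + A 1 1) := by
  have hdet : (A 0 0 : ℂ) * A 1 1 - A 0 1 * A 1 0 = 1 := by exact_mod_cast det_entries A
  rw [mk_smul_coe]
  split_ifs with h
  · simp only [OnePoint.infty_ne_coe, false_iff, h, mul_zero]
    intro h1
    have : (A 0 0 : ℂ) * (A 1 0 * z + A 1 1) - A 1 0 * (A 0 0 * z + A 0 1) = 0 := by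
      rw [h, h1]; ring
    rw [show (A 0 0 : ℂ) * (A 1 0 * z + A 1 1) - A 1 0 * (A 0 0 * z + A 0 1) =
      A 0 0 * A 1 1 - A 0 1 * A 1 0 by ring, hdet] at this
    exact one_ne_zero this
  · rw [OnePoint.coe_eq_coe, div_eq_iff h]

theorem isNonrepellingFixed_ofReal_iff (A : SL(2, ℝ)) (x : ℝ) :
    IsNonrepellingFixed (mk A) ((x : ℂ) : OnePoint ℂ) ↔
      A 0 0 * x + A 0 1 = x * (A 1 0 * x + A 1 1) ∧ 1 ≤ |A 1 0 * x + A 1 1| := by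
  rw [← mk_inftyTo_smul, show mk A = mk (inftyTo x) * mk ((inftyTo x)⁻¹ * A * inftyTo x) *
    (mk (inftyTo x))⁻¹ by rw [← map_inv, ← map_mul, ← map_mul]; group,
    isNonrepellingFixed_conj_iff, isNonrepellingFixed_infty_iff, (inftyTo_conj A x).1,
    (inftyTo_conj A x).2, sub_eq_zero, eq_comm]

/-- The fixed point equation at `x + iy` determines `a - d` and `b` from `c`, and gives `(a + d)² =
4 - 4 c² y²`. -/
theorem not_isHyperbolic_of_fixed (A : SL(2, ℝ)) (z : UpperHalfPlane)
    (h : (A 0 0 : ℂ) * z + A 0 1 = z * (A 1 0 * z + A 1 1)) : ¬ IsHyperbolic (mk A) := by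
  rw [isHyperbolic_mk_iff, not_lt]
  have hdet := det_entries A
  have h1 := congrArg Complex.re h
  have h2 := congrArg Complex.im h
  simp at h1 h2
  have hy := z.im_pos
  have h3 : A 0 0 - A 1 1 = 2 * A 1 0 * z.re := by
    apply mul_right_cancel₀ hy.ne'
    linarith
  have h4 : A 0 1 = - (A 1 0 * (z.re ^ 2 + z.im ^ 2)) := by
    linear_combination h1 - z.re * h3
  have h5 : (A 0 0 + A 1 1) ^ 2 = (A 0 0 - A 1 1) ^ 2 + 4 * (1 + A 0 1 * A 1 0) := by
    linear_combination 4 * hdet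
  rw [h5, h3, h4]
  nlinarith [sq_nonneg (A 1 0 * z.im)]

/-- One criterion for interior and real points. At an interior fixed point `|c z + d| = 1`
automatically, because the imaginary part is preserved; at a real one the derivative is `1 / (c x +
d)²`. -/
theorem isNonrepellingFixed_coe_iff (A : SL(2, ℝ)) (z : ℂ) (hz : 0 ≤ z.im) :
    IsNonrepellingFixed (mk A) (z : OnePoint ℂ) ↔
      (A 0 0 : ℂ) * z + A 0 1 = z * (A 1 0 * z + A 1 1) ∧
        1 ≤ Complex.normSq ((A 1 0 : ℂ) * z + A 1 1) := by
  rcases hz.eq_or_lt with h0 | hpos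
  · obtain ⟨x, rfl⟩ : ∃ x : ℝ, (x : ℂ) = z := ⟨z.re, Complex.ext rfl h0⟩
    rw [isNonrepellingFixed_ofReal_iff]
    refine and_congr (by norm_cast) ?_
    norm_cast
    rw [Complex.normSq_ofReal, ← sq, one_le_sq_iff_one_le_abs]
  · lift z to UpperHalfPlane using hpos
    unfold IsNonrepellingFixed
    rw [smul_coe_eq_self_iff]
    refine and_congr_right fun h => ?_
    refine iff_of_true (fun H => not_isHyperbolic_of_fixed A z h H.1) ?_
    have h1 : mk A • z = z := by
      ext
      rw [coe_mk_smul, div_eq_iff (denom_ne_zero A z), h]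
    have h2 := im_mk_smul A z
    rw [h1, eq_div_iff (Complex.normSq_pos.mpr (denom_ne_zero A z)).ne'] at h2
    exact (mul_left_cancel₀ z.im_pos.ne' (h2.trans (mul_one _).symm)).ge

theorem isNonrepellingFixed_toSphere {h : G0} {z : UpperHalfPlane} (hz : h • z = z) :
    IsNonrepellingFixed h (toSphere z) := by
  obtain ⟨A, rfl⟩ := mk_surjective h
  have h1 : mk A • toSphere z = toSphere z := by rw [← toSphere_smul, hz]
  refine ⟨h1, fun H => ?_⟩
  exact not_isHyperbolic_of_fixed A z ((smul_coe_eq_self_iff A z).mp h1) H.1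

end AdS

/-! ### The imaginary axis as a normal form for lines and their sides -/

namespace HypPlane

open G0

/-- The point `i * exp s` of the upper half-plane. -/
noncomputable def axisPt (s : ℝ) : UpperHalfPlane := UpperHalfPlane.mk ⟨0, Real.exp s⟩ (Real.exp_pos s)

@[simp] theorem axisPt_re (s : ℝ) : (axisPt s).re = 0 := rfl

@[simp] theorem axisPt_im (s : ℝ) : (axisPt s).im = Real.exp s := rfl

theorem coe_axisPt (s : ℝ) : (axisPt s : ℂ) = Real.exp s * Complex.I := by
  apply Complex.ext <;> simp [axisPt, -Complex.ofReal_exp]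

theorem isometry_axisPt : Isometry axisPt := UpperHalfPlane.isometry_vertical_line 0

theorem axisPt_zero : axisPt 0 = UpperHalfPlane.I := by
  ext
  simp [coe_axisPt]

theorem eq_axisPt {z : UpperHalfPlane} (h : z.re = 0) : z = axisPt (Real.log z.im) := by
  apply UpperHalfPlane.ext_re_im
  · simp [h]
  · simp [Real.exp_log z.im_pos]

/-- The imaginary axis. -/
def axis : Set UpperHalfPlane := {z | z.re = 0}

theorem range_axisPt : Set.range axisPt = axis := by
  ext z
  exact ⟨by rintro ⟨s, rfl⟩; exact axisPt_re s, fun h => ⟨_, (eq_axisPt h).symm⟩⟩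

/-- The points of the upper half-plane with positive real part. -/
def rightHalf : Set UpperHalfPlane := {z | 0 < z.re}

/-- The points of the upper half-plane with negative real part. -/
def leftHalf : Set UpperHalfPlane := {z | z.re < 0}

/-- The rotation of angle `π` about `i`, lifted to `SL(2, ℝ)`. -/
def halfTurn : SL(2, ℝ) := ofEntries 0 (-1) 1 0 (by norm_num)

theorem re_mk_smul (A : SL(2, ℝ)) (z : UpperHalfPlane) :
    (mk A • z).re = (A 0 0 * A 1 0 * Complex.normSq z + A 0 1 * A 1 1 +
      (A 0 0 * A 1 1 + A 0 1 * A 1 0) * z.re) / Complex.normSq (A 1 0 * z + A 1 1) := by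
  rw [← UpperHalfPlane.coe_re, coe_mk_smul, Complex.div_re, ← add_div]
  congr 1
  simp only [Complex.add_re, Complex.add_im, Complex.mul_re, Complex.mul_im, Complex.ofReal_re,
    Complex.ofReal_im, UpperHalfPlane.coe_re, UpperHalfPlane.coe_im, Complex.normSq_apply]
  ring

theorem normSq_pos (z : UpperHalfPlane) : 0 < Complex.normSq z :=
  Complex.normSq_pos.mpr (UpperHalfPlane.ne_zero z)

theorem halfTurn_re (z : UpperHalfPlane) : (mk halfTurn • z).re = - z.re / Complex.normSq z := by
  rw [re_mk_smul]
  simp [halfTurn]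

theorem halfTurn_im (z : UpperHalfPlane) : (mk halfTurn • z).im = z.im / Complex.normSq z := by
  rw [im_mk_smul]
  simp [halfTurn]

theorem halfTurn_inv : (mk halfTurn)⁻¹ = mk halfTurn := by
  rw [← map_inv, mk_eq_mk_iff]
  right
  apply ext_entries <;> simp [halfTurn]

theorem halfTurn_smul_axisPt (s : ℝ) : mk halfTurn • axisPt s = axisPt (-s) := by
  apply UpperHalfPlane.ext_re_im
  · rw [halfTurn_re]; simp
  · rw [halfTurn_im]
    simp [Complex.normSq_apply, Real.exp_neg, axisPt]

theorem halfTurn_smul_axis : mk halfTurn • axis = axis := by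
  ext z
  rw [Set.mem_smul_set_iff_inv_smul_mem, halfTurn_inv]
  change (mk halfTurn • z).re = 0 ↔ z.re = 0
  rw [halfTurn_re, div_eq_zero_iff, neg_eq_zero, or_iff_left (normSq_pos z).ne']

theorem halfTurn_smul_rightHalf : mk halfTurn • rightHalf = leftHalf := by
  ext z
  rw [Set.mem_smul_set_iff_inv_smul_mem, halfTurn_inv]
  simp only [rightHalf, leftHalf, Set.mem_ofPred_eq, halfTurn_re]
  rw [lt_div_iff₀ (normSq_pos z)]
  simp

/-- Some rotation about `i` sends a given point to the imaginary axis, above `i`. -/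
theorem exists_rotation_smul_eq_axisPt (z : UpperHalfPlane) :
    ∃ h : G0, h • UpperHalfPlane.I = UpperHalfPlane.I ∧
      h • z = axisPt (dist UpperHalfPlane.I z) := by
  obtain ⟨A, hA, hz⟩ : ∃ A : SL(2, ℝ), mk A • UpperHalfPlane.I = UpperHalfPlane.I ∧
      (mk A • z).re = 0 := by
    -- The rotated point has real part proportional to `sin 2θ (1 - |z|²) / 2 + cos 2θ Re z`; this
    -- vanishes when `2θ` is the argument of `w`.
    set w : ℂ := ⟨(1 - Complex.normSq z) / 2, - z.re⟩ with hw
    set θ := w.arg / 2 with hθ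
    have hcs := Real.cos_sq_add_sin_sq θ
    refine ⟨ofEntries (Real.cos θ) (Real.sin θ) (-Real.sin θ) (Real.cos θ) (by nlinarith), ?_, ?_⟩
    · ext
      rw [coe_mk_smul, div_eq_iff (denom_ne_zero _ _)]
      apply Complex.ext <;> simp
    · rw [re_mk_smul]
      have h1 : ‖w‖ * Real.cos (2 * θ) = (1 - Complex.normSq z) / 2 := by
        rw [hθ, mul_div_cancel₀ _ two_ne_zero, Complex.norm_mul_cos_arg]
      have h2 : ‖w‖ * Real.sin (2 * θ) = - z.re := by
        rw [hθ, mul_div_cancel₀ _ two_ne_zero, Complex.norm_mul_sin_arg]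
      rw [Real.cos_two_mul'] at h1
      rw [Real.sin_two_mul] at h2
      apply div_eq_zero_iff.mpr
      left
      simp only [ofEntries_00, ofEntries_01, ofEntries_10, ofEntries_11]
      by_cases h0 : ‖w‖ = 0
      · rw [h0, zero_mul] at h1 h2
        have e1 : Complex.normSq z = 1 := by linarith
        have e2 : z.re = 0 := by linarith
        rw [e1, e2]; ring
      · linear_combination (-2 * Real.cos θ * Real.sin θ) * h1 + (Real.cos θ ^ 2 - Real.sin θ ^ 2) * h2
  have hd : dist UpperHalfPlane.I z = |Real.log (mk A • z).im| := by
    rw [← dist_smul (mk A), hA, eq_axisPt hz, ← axisPt_zero, isometry_axisPt.dist_eq]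
    simp [Real.dist_eq]
  rcases le_total 0 (Real.log (mk A • z).im) with h | h
  · exact ⟨mk A, hA, by rw [hd, abs_of_nonneg h]; exact eq_axisPt hz⟩
  · refine ⟨mk halfTurn * mk A, ?_, ?_⟩
    · rw [mul_smul, hA, ← axisPt_zero, halfTurn_smul_axisPt, neg_zero]
    · rw [mul_smul, hd, abs_of_nonpos h, ← halfTurn_smul_axisPt, ← eq_axisPt hz]

theorem exists_smul_I_eq (z : UpperHalfPlane) : ∃ g : G0, g • UpperHalfPlane.I = z :=
  ⟨mk z.toSL2R, z.toSL2R_smul_I⟩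

/-- Rotations about a point act transitively on the circles about this point. -/
theorem exists_smul_eq_of_dist_eq {p z w : UpperHalfPlane} (h : dist p z = dist p w) :
    ∃ g : G0, g • p = p ∧ g • z = w := by
  obtain ⟨k, rfl⟩ := exists_smul_I_eq p
  obtain ⟨r, hr, hz⟩ := exists_rotation_smul_eq_axisPt (k⁻¹ • z)
  obtain ⟨r', hr', hw⟩ := exists_rotation_smul_eq_axisPt (k⁻¹ • w)
  have e : dist UpperHalfPlane.I (k⁻¹ • z) = dist UpperHalfPlane.I (k⁻¹ • w) := by
    rw [← dist_smul k, ← dist_smul k UpperHalfPlane.I (k⁻¹ • w), smul_inv_smul, smul_inv_smul, h]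
  refine ⟨k * r'⁻¹ * r * k⁻¹, ?_, ?_⟩
  · rw [mul_smul, mul_smul, mul_smul, inv_smul_smul, hr, smul_left_cancel_iff, inv_smul_eq_iff, hr']
  · rw [mul_smul, mul_smul, mul_smul, hz, e, ← hw, inv_smul_smul, smul_inv_smul]

/-- The two `cosh` formulas have the same unknown `x² + y²`; eliminating it determines `y`, and then
`x = 0`. -/
theorem eq_axisPt_of_dist {z : UpperHalfPlane} {t : ℝ} (h0 : dist z (axisPt 0) = |t|)
    (h1 : dist z (axisPt 1) = |t - 1|) : z = axisPt t := by
  have e0 := UpperHalfPlane.cosh_dist' z (axisPt 0)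
  have e1 := UpperHalfPlane.cosh_dist' z (axisPt 1)
  rw [h0, Real.cosh_abs] at e0
  rw [h1, Real.cosh_abs] at e1
  have hy := z.im_pos
  have hE := Real.exp_pos 1
  simp only [axisPt_re, axisPt_im, Real.exp_zero] at e0 e1
  rw [eq_div_iff (by positivity), Real.cosh_eq] at e0 e1
  have hE1 : 1 < Real.exp 1 := by simp
  have hT := Real.exp_pos t
  rw [show -(t - 1) = 1 - t by ring, Real.exp_sub, Real.exp_sub] at e1
  rw [Real.exp_neg] at e0
  have key : z.im = Real.exp t := by
    field_simp at e0 e1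
    have h3 : (Real.exp 1 ^ 2 - 1) * (z.im - Real.exp t) = 0 := by
      linear_combination e1 - e0
    have : Real.exp 1 ^ 2 - 1 ≠ 0 := by nlinarith
    linarith [(mul_eq_zero.mp h3).resolve_left this]
  have hx : z.re = 0 := by
    rw [key] at e0
    field_simp at e0
    have : z.re ^ 2 = 0 := by linarith
    exact pow_eq_zero_iff two_ne_zero |>.mp this
  exact UpperHalfPlane.ext_re_im (by simp [hx]) (by simp [key])

/-- An isometry places `γ 0` and `γ 1` at `axisPt 0` and `axisPt 1`; every other `γ t` is then
determined by its distances to these two points. -/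
theorem IsGeodesicLine.exists_eq_smul_axis {l : Set UpperHalfPlane} (hl : IsGeodesicLine l) :
    ∃ k : G0, l = k • axis := by
  obtain ⟨γ, hγ, rfl⟩ := hl
  obtain ⟨g, hg⟩ := exists_smul_I_eq (γ 0)
  obtain ⟨r, hr, hr1⟩ := exists_rotation_smul_eq_axisPt (g⁻¹ • γ 1)
  have hd : dist UpperHalfPlane.I (g⁻¹ • γ 1) = 1 := by
    rw [← dist_smul g, hg, smul_inv_smul, hγ.dist_eq]
    simp
  rw [hd] at hr1
  have hI : (r * g⁻¹) • γ 0 = axisPt 0 := by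
    rw [mul_smul, ← hg, inv_smul_smul, hr, axisPt_zero]
  have h1 : (r * g⁻¹) • γ 1 = axisPt 1 := by rw [mul_smul, hr1]
  have key : ∀ t, (r * g⁻¹) • γ t = axisPt t := by
    intro t
    apply eq_axisPt_of_dist
    · rw [← hI, dist_smul, hγ.dist_eq]; simp
    · rw [← h1, dist_smul, hγ.dist_eq, Real.dist_eq]
  refine ⟨(r * g⁻¹)⁻¹, ?_⟩
  rw [← range_axisPt, ← Set.image_smul, ← Set.range_comp]
  congr 1
  ext1 t
  simp only [Function.comp, ← key t, inv_smul_smul]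

theorem isPreconnected_rightHalf : IsPreconnected rightHalf := by
  have h : IsPreconnected {z : ℂ | 0 < z.re ∧ 0 < z.im} := by
    apply Convex.isPreconnected
    exact (convex_halfSpace_re_gt 0).inter (convex_halfSpace_im_gt 0)
  rw [← UpperHalfPlane.isOpenEmbedding_coe.isInducing.isPreconnected_image]
  convert h using 1
  ext z
  constructor
  · rintro ⟨w, hw, rfl⟩
    exact ⟨hw, w.im_pos⟩
  · rintro ⟨h1, h2⟩
    exact ⟨⟨z, h2⟩, h1, rfl⟩

theorem connectedComponentIn_compl_axis {z : UpperHalfPlane} (hz : z ∈ rightHalf) :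
    connectedComponentIn axisᶜ z = rightHalf := by
  have hsub : rightHalf ⊆ axisᶜ := fun w (hw : 0 < w.re) (h : w.re = 0) => hw.ne' h
  refine Set.Subset.antisymm (fun w hw => ?_)
    (isPreconnected_rightHalf.subset_connectedComponentIn hz hsub)
  by_contra hneg
  have hneg' : w.re ≤ 0 := not_lt.mp hneg
  have hcont : ContinuousOn UpperHalfPlane.re (connectedComponentIn axisᶜ z) :=
    UpperHalfPlane.continuous_re.continuousOn
  -- The real part cannot change sign on a connected set that avoids the axis.
  obtain ⟨v, hv, hv0⟩ := isPreconnected_connectedComponentIn.intermediate_value hw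
    (mem_connectedComponentIn (hsub hz)) hcont ⟨hneg', le_of_lt hz⟩
  exact connectedComponentIn_subset _ _ hv hv0

/-- A geodesic line with a transverse orientation is the image of the imaginary axis, oriented to
the right. -/
theorem IsSide.exists_eq_smul {l P : Set UpperHalfPlane} (hl : IsGeodesicLine l)
    (hP : IsSide l P) : ∃ k : G0, l = k • axis ∧ P = k • rightHalf := by
  obtain ⟨k, rfl⟩ := hl.exists_eq_smul_axis
  obtain ⟨z, hz, rfl⟩ := hP
  have key : ∀ (k : G0) (z : UpperHalfPlane), z ∈ (k • axis)ᶜ → k⁻¹ • z ∈ rightHalf →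
      connectedComponentIn (k • axis)ᶜ z = k • rightHalf := by
    intro k z hz hr
    rw [← connectedComponentIn_compl_axis hr]
    have h1 : k⁻¹ • z ∈ axisᶜ := by
      rwa [← Set.smul_set_compl, Set.mem_smul_set_iff_inv_smul_mem] at hz
    have := (Homeomorph.smul k).image_connectedComponentIn h1
    change (fun x => k • x) '' _ = connectedComponentIn ((fun x => k • x) '' _) (k • (k⁻¹ • z)) at this
    rw [Set.image_smul, Set.image_smul, smul_inv_smul, Set.smul_set_compl] at this
    exact this.symm
  have h1 : k⁻¹ • z ∈ axisᶜ := by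
    rwa [← Set.smul_set_compl, Set.mem_smul_set_iff_inv_smul_mem] at hz
  rcases lt_or_gt_of_ne (show (k⁻¹ • z).re ≠ 0 from h1) with h | h
  -- The half-turn preserves the axis and exchanges its sides, so it reduces the left side to the
  -- right one.
  · have e : (k * mk halfTurn) • axis = k • axis := by rw [mul_smul, halfTurn_smul_axis]
    refine ⟨k * mk halfTurn, e.symm, ?_⟩
    rw [← e]
    refine key _ _ (by rwa [e]) ?_
    rw [mul_inv_rev, mul_smul]
    rw [← Set.mem_smul_set_iff_inv_smul_mem, halfTurn_smul_rightHalf]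
    exact h
  · exact ⟨k, rfl, key k z hz h⟩

/-! ### Closures in the compactification -/

theorem coe_mem_bar_iff {s : Set UpperHalfPlane} {z : ℂ} :
    (z : OnePoint ℂ) ∈ bar s ↔ z ∈ closure (UpperHalfPlane.coe '' s) := by
  rw [OnePoint.isOpenEmbedding_coe.isInducing.closure_eq_preimage_closure_image, ← Set.image_comp]
  rfl

theorem infty_mem_bar {s : Set UpperHalfPlane} {f : ℕ → UpperHalfPlane} (hf : ∀ n, f n ∈ s)
    (h : ∀ n : ℕ, (n : ℝ) ≤ (f n).im) : OnePoint.infty ∈ bar s := by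
  refine mem_closure_of_tendsto (b := atTop) (f := fun n => toSphere (f n)) ?_
    (Eventually.of_forall fun n => ⟨_, hf n, rfl⟩)
  apply tendsto_coe_infty
  refine tendsto_atTop_mono (fun n => ?_) tendsto_natCast_atTop_atTop
  exact (h n).trans ((le_abs_self _).trans (Complex.abs_im_le_norm _))

theorem mem_closure_coe_image {s : Set UpperHalfPlane} {z : ℂ} (v : ℂ)
    (h : ∀ ε : ℝ, 0 < ε → ∃ w ∈ s, (w : ℂ) = z + ε * v) : z ∈ closure (UpperHalfPlane.coe '' s) := by
  have h1 : Tendsto (fun n : ℕ => z + ((1 / ((n : ℝ) + 1) : ℝ) : ℂ) * v) atTop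
      (𝓝 (z + ((0 : ℝ) : ℂ) * v)) :=
    tendsto_const_nhds.add ((Complex.continuous_ofReal.tendsto _ |>.comp
      tendsto_one_div_add_atTop_nhds_zero_nat).mul_const v)
  simp only [Complex.ofReal_zero, zero_mul, add_zero] at h1
  refine mem_closure_of_tendsto h1 (Eventually.of_forall fun n => ?_)
  obtain ⟨w, hw, hw'⟩ := h (1 / ((n : ℝ) + 1)) (by positivity)
  exact ⟨w, hw, hw'⟩

theorem isClosed_re_im {S T : Set ℝ} (hS : IsClosed S) (hT : IsClosed T) :
    IsClosed {z : ℂ | z.re ∈ S ∧ z.im ∈ T} :=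
  (hS.preimage Complex.continuous_re).inter (hT.preimage Complex.continuous_im)

theorem coe_mem_bar_axis {z : ℂ} : (z : OnePoint ℂ) ∈ bar axis ↔ z.re = 0 ∧ 0 ≤ z.im := by
  rw [coe_mem_bar_iff]
  constructor
  · refine fun h => closure_minimal ?_ (isClosed_re_im isClosed_singleton isClosed_Ici) h
    rintro _ ⟨w, hw, rfl⟩
    exact ⟨hw, w.im_pos.le⟩
  · rintro ⟨h1, h2⟩
    refine mem_closure_coe_image Complex.I fun ε hε => ⟨⟨z + ε * Complex.I, ?_⟩, ?_, rfl⟩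
    · simp; linarith
    · change (z + ε * Complex.I).re = 0
      simp [h1]

theorem coe_mem_bar_rightHalf {z : ℂ} :
    (z : OnePoint ℂ) ∈ bar rightHalf ↔ 0 ≤ z.re ∧ 0 ≤ z.im := by
  rw [coe_mem_bar_iff]
  constructor
  · refine fun h => closure_minimal ?_ (isClosed_re_im isClosed_Ici isClosed_Ici) h
    rintro _ ⟨w, hw, rfl⟩
    exact ⟨le_of_lt (show 0 < w.re from hw), w.im_pos.le⟩
  · rintro ⟨h1, h2⟩
    refine mem_closure_coe_image (1 + Complex.I) fun ε hε =>
      ⟨⟨z + ε * (1 + Complex.I), ?_⟩, ?_, rfl⟩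
    · simp; linarith
    · change 0 < (z + ε * (1 + Complex.I)).re
      simp; linarith

theorem coe_mem_bar_univ {z : ℂ} : (z : OnePoint ℂ) ∈ bar Set.univ ↔ 0 ≤ z.im := by
  rw [coe_mem_bar_iff]
  constructor
  · intro h
    refine (closure_minimal ?_ (isClosed_re_im isClosed_univ isClosed_Ici) h).2
    rintro _ ⟨w, hw, rfl⟩
    exact ⟨trivial, w.im_pos.le⟩
  · intro h2
    refine mem_closure_coe_image Complex.I fun ε hε => ⟨⟨z + ε * Complex.I, ?_⟩, trivial, rfl⟩
    simp; linarith

theorem infty_mem_bar_axis : OnePoint.infty ∈ bar axis :=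
  infty_mem_bar (f := fun n : ℕ => axisPt n) (fun n => axisPt_re _) fun n => by
    simp only [axisPt_im]
    linarith [Real.add_one_le_exp (n : ℝ)]

theorem infty_mem_boundary : OnePoint.infty ∈ boundary :=
  ⟨closure_mono (Set.image_mono (Set.subset_univ _)) infty_mem_bar_axis, by
    rintro ⟨z, hz⟩
    exact OnePoint.coe_ne_infty _ hz⟩

theorem coe_mem_boundary {z : ℂ} : (z : OnePoint ℂ) ∈ boundary ↔ z.im = 0 := by
  unfold boundary
  rw [Set.mem_sdiff, coe_mem_bar_univ]
  constructor
  · rintro ⟨h1, h2⟩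
    by_contra h3
    exact h2 ⟨⟨z, lt_of_le_of_ne h1 (Ne.symm h3)⟩, rfl⟩
  · intro h
    refine ⟨h.ge, ?_⟩
    rintro ⟨w, hw⟩
    have := OnePoint.coe_injective hw
    rw [← this] at h
    exact w.im_pos.ne' h

theorem endpoints_axis : endpoints axis = {OnePoint.infty, ((0 : ℂ) : OnePoint ℂ)} := by
  ext x
  induction x using OnePoint.rec with
  | infty => simp [endpoints, infty_mem_bar_axis, infty_mem_boundary]
  | coe z =>
    simp only [endpoints, Set.mem_inter_iff, coe_mem_bar_axis, coe_mem_boundary,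
      Set.mem_insert_iff, OnePoint.coe_ne_infty, false_or, Set.mem_singleton_iff,
      OnePoint.coe_eq_coe, Complex.ext_iff, Complex.zero_re, Complex.zero_im]
    constructor
    · rintro ⟨⟨h1, -⟩, h2⟩; exact ⟨h1, h2⟩
    · rintro ⟨h1, h2⟩; exact ⟨⟨h1, h2.ge⟩, h2⟩

theorem halfTurn_smul_infty :
    mk halfTurn • (OnePoint.infty : OnePoint ℂ) = ((0 : ℂ) : OnePoint ℂ) := by
  rw [mk_smul_infty]
  simp [halfTurn]

end HypPlane

/-! ### Distances between two lines and the uniform gap -/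

namespace HypPlane

open G0

/-- With the denominator of the Möbius map cleared, the matrix entries appear linearly; both the
exact formula on the axis and the asymptotics at infinity come from here. -/
theorem sinh_half_dist_mk_smul (B : SL(2, ℝ)) (x y : UpperHalfPlane) :
    Real.sinh (dist (mk B • x) y / 2) =
      ‖(B 0 0 : ℂ) * x + B 0 1 - y * (B 1 0 * x + B 1 1)‖ / (2 * √(x.im * y.im)) := by
  have hq := denom_ne_zero B x
  have hq' := norm_pos_iff.mpr hq
  rw [UpperHalfPlane.sinh_half_dist, coe_mk_smul, im_mk_smul, Complex.dist_eq, div_sub' hq, norm_div,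
    Complex.normSq_eq_norm_sq, div_mul_eq_mul_div, Real.sqrt_div' _ (sq_nonneg _),
    Real.sqrt_sq hq'.le]
  have : √(x.im * y.im) ≠ 0 := (Real.sqrt_pos.mpr (mul_pos x.im_pos y.im_pos)).ne'
  rw [mul_comm (y : ℂ)]
  generalize (B 1 0 : ℂ) * x + B 1 1 = q at *
  field_simp

/-- The distance between points of two lines, in terms of the entries of a matrix. -/
theorem two_cosh_dist_axisPt (B : SL(2, ℝ)) (s t : ℝ) :
    2 * Real.cosh (dist (mk B • axisPt s) (axisPt t)) =
      B 0 0 ^ 2 * Real.exp (s - t) + B 1 1 ^ 2 / Real.exp (s - t) +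
      B 1 0 ^ 2 * Real.exp (s + t) + B 0 1 ^ 2 / Real.exp (s + t) := by
  have h1 : dist (mk B • axisPt s) (axisPt t) = 2 * (dist (mk B • axisPt s) (axisPt t) / 2) := by ring
  have hdet := det_entries B
  rw [h1, Real.cosh_two_mul, Real.cosh_sq, sinh_half_dist_mk_smul, div_pow, ← Complex.normSq_eq_norm_sq,
    mul_pow, Real.sq_sqrt (mul_pos (axisPt s).im_pos (axisPt t).im_pos).le, coe_axisPt, coe_axisPt,
    Complex.normSq_apply, Real.exp_sub, Real.exp_add]
  have hs := Real.exp_pos s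
  have ht := Real.exp_pos t
  simp [-Complex.ofReal_exp]
  field_simp
  linear_combination -4 * Real.exp s * Real.exp t * hdet

/-- All entries of `B₁` are larger than the corresponding entries of `B₀`, in absolute value. -/
def Dominates (B₁ B₀ : SL(2, ℝ)) : Prop := ∀ i j, |B₀ i j| < |B₁ i j|

theorem dominates_iff {B₁ B₀ : SL(2, ℝ)} : Dominates B₁ B₀ ↔
    (|B₀ 0 0| < |B₁ 0 0| ∧ |B₀ 0 1| < |B₁ 0 1|) ∧ |B₀ 1 0| < |B₁ 1 0| ∧ |B₀ 1 1| < |B₁ 1 1| := by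
  simp only [Dominates, Fin.forall_fin_two]

theorem cosh_add_le {x K : ℝ} (hK : 0 ≤ K) : Real.cosh (x + K) ≤ Real.exp K * Real.cosh x := by
  rw [Real.cosh_eq, Real.cosh_eq, neg_add, Real.exp_add, Real.exp_add]
  have h1 : Real.exp (-K) ≤ Real.exp K := Real.exp_le_exp.mpr (by linarith)
  have h2 := mul_le_mul_of_nonneg_left h1 (Real.exp_pos (-x)).le
  linarith

/-- Four strict inequalities between squares leave room for a common factor `c > 1`. The forms then
have ratio at least `c`, and `cosh (x + log c) ≤ c cosh x` turns this into the additive gap `log c`.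
-/
theorem Dominates.exists_uniform_gap {B₁ B₀ : SL(2, ℝ)} (h : Dominates B₁ B₀) :
    ∃ K : ℝ, 0 < K ∧ ∀ s t, K ≤ dist (mk B₁ • axisPt s) (axisPt t) -
      dist (mk B₀ • axisPt s) (axisPt t) := by
  have key : ∀ i j, ∀ᶠ c : ℝ in 𝓝[>] 1, c * B₀ i j ^ 2 < B₁ i j ^ 2 := by
    intro i j
    have h1 : Tendsto (fun c : ℝ => c * B₀ i j ^ 2) (𝓝[>] 1) (𝓝 (1 * B₀ i j ^ 2)) :=
      tendsto_nhdsWithin_of_tendsto_nhds (Continuous.tendsto (by fun_prop) _)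
    exact h1.eventually_lt_const (by rw [one_mul]; exact sq_lt_sq.mpr (h i j))
  obtain ⟨c, hc00, hc01, hc10, hc11, hc⟩ := ((key 0 0).and ((key 0 1).and ((key 1 0).and
    ((key 1 1).and (self_mem_nhdsWithin))))).exists
  replace hc : 1 < c := hc
  refine ⟨Real.log c, Real.log_pos hc, fun s t => ?_⟩
  rw [le_sub_iff_add_le', ← abs_of_nonneg (add_nonneg dist_nonneg (Real.log_pos hc).le),
    ← abs_of_nonneg (dist_nonneg (x := mk B₁ • axisPt s)), ← Real.cosh_le_cosh]
  refine (cosh_add_le (Real.log_pos hc).le).trans ?_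
  rw [Real.exp_log (by linarith)]
  have e1 := two_cosh_dist_axisPt B₁ s t
  have e0 := two_cosh_dist_axisPt B₀ s t
  have f1 := mul_le_mul_of_nonneg_right hc00.le (Real.exp_pos (s - t)).le
  have f2 := div_le_div_of_nonneg_right hc11.le (Real.exp_pos (s - t)).le
  have f3 := mul_le_mul_of_nonneg_right hc10.le (Real.exp_pos (s + t)).le
  have f4 := div_le_div_of_nonneg_right hc01.le (Real.exp_pos (s + t)).le
  have : c * (2 * Real.cosh (dist (mk B₀ • axisPt s) (axisPt t))) ≤
      2 * Real.cosh (dist (mk B₁ • axisPt s) (axisPt t)) := by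
    rw [e1, e0]
    simp only [mul_add, ← mul_div_assoc, ← mul_assoc]
    gcongr
  linarith

theorem exists_pos_of_leading_pos {α : ℝ} (hα : 0 < α) (β ε : ℝ) :
    ∃ X : ℝ, 0 < X ∧ 0 < α * X + β / X + ε := by
  have h0 : 0 ≤ (|β| + |ε| + 1) / α := by positivity
  -- With this `X ≥ 1`, one has `|β / X| ≤ |β|` while `α X = |β| + |ε| + 1 + α`.
  refine ⟨(|β| + |ε| + 1) / α + 1, by linarith, ?_⟩
  set X := (|β| + |ε| + 1) / α + 1 with hX
  have h1 : 1 ≤ X := by linarith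
  have h2 : α * X = |β| + |ε| + 1 + α := by rw [hX]; field_simp
  have h3 : - |β| ≤ β / X := by
    have : |β / X| ≤ |β| := by
      rw [abs_div, abs_of_pos (show 0 < X by linarith)]
      exact div_le_self (abs_nonneg _) h1
    exact (neg_le_neg this).trans (neg_abs_le _)
  linarith [neg_abs_le ε]

/-- Letting `X` tend to infinity gives `C p₀² ≤ p₁²`, which is strict unless both vanish; the
determinants exclude that case. They enter squared because permuting the roles of the four entries
may change their sign. -/
theorem abs_lt_abs_of_form_le {C p₁ q₁ r₁ s₁ p₀ q₀ r₀ s₀ : ℝ} (hC : 1 < C)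
    (hd₁ : (p₁ * q₁ - r₁ * s₁) ^ 2 = 1) (hd₀ : (p₀ * q₀ - r₀ * s₀) ^ 2 = 1)
    (h : ∀ X Y : ℝ, 0 < X → 0 < Y → C * (p₀ ^ 2 * X + q₀ ^ 2 / X + r₀ ^ 2 * Y + s₀ ^ 2 / Y) ≤
      p₁ ^ 2 * X + q₁ ^ 2 / X + r₁ ^ 2 * Y + s₁ ^ 2 / Y) : |p₀| < |p₁| := by
  have h1 : C * p₀ ^ 2 ≤ p₁ ^ 2 := by
    by_contra! hlt
    obtain ⟨X, hX, hpos⟩ := exists_pos_of_leading_pos (sub_pos.mpr hlt) (C * q₀ ^ 2 - q₁ ^ 2)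
      (C * (r₀ ^ 2 + s₀ ^ 2) - (r₁ ^ 2 + s₁ ^ 2))
    have := h X 1 hX one_pos
    rw [sub_div, sub_mul, mul_div_assoc] at hpos
    simp only [mul_one, div_one] at this
    linarith
  rw [← sq_lt_sq]
  rcases eq_or_ne p₀ 0 with h0 | h0
  · rw [h0]
    have : p₁ ≠ 0 := by
      rintro rfl
      rw [h0] at hd₀ h
      have e0 : r₀ ^ 2 * s₀ ^ 2 = 1 := by linarith
      have e1 : r₁ ^ 2 * s₁ ^ 2 = 1 := by linarith
      have hs : 0 < s₁ ^ 2 := by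
        rcases (sq_nonneg s₁).eq_or_lt with h | h
        · rw [← h] at e1; simp at e1
        · exact h
      -- If `p₀ = p₁ = 0`, take `Y = s₁²`: the right-hand form tends to 2 as `X` grows, while the
      -- left-hand one is at least `2 C` by the inequality of arithmetic and geometric means.
      have hlow : 2 ≤ r₀ ^ 2 * s₁ ^ 2 + s₀ ^ 2 / s₁ ^ 2 := by
        have : r₀ ^ 2 * s₁ ^ 2 * (s₀ ^ 2 / s₁ ^ 2) = 1 := by
          rw [mul_assoc, mul_div_cancel₀ _ hs.ne', e0]
        nlinarith [sq_nonneg (r₀ ^ 2 * s₁ ^ 2 - s₀ ^ 2 / s₁ ^ 2),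
          show 0 ≤ r₀ ^ 2 * s₁ ^ 2 by positivity, show 0 ≤ s₀ ^ 2 / s₁ ^ 2 by positivity]
      have hgap : 0 < 2 * C - 2 := by linarith
      obtain ⟨X, hX, hpos⟩ := exists_pos_of_leading_pos hgap 0 (- q₁ ^ 2)
      have := h X (s₁ ^ 2) hX hs
      rw [e1, div_self hs.ne'] at this
      have h5 : 0 ≤ C * (q₀ ^ 2 / X) := by positivity
      have h6 : q₁ ^ 2 / X < 2 * C - 2 := by
        rw [div_lt_iff₀ hX]
        simp at hpos
        linarith
      nlinarith
    have := sq_pos_of_ne_zero this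
    linarith
  · have := sq_pos_of_ne_zero h0
    nlinarith

theorem dominates_of_uniform_gap {B₁ B₀ : SL(2, ℝ)} {K : ℝ} (hK : 0 < K)
    (h : ∀ s t, K ≤ dist (mk B₁ • axisPt s) (axisPt t) - dist (mk B₀ • axisPt s) (axisPt t)) :
    Dominates B₁ B₀ := by
  have hC : 1 < Real.cosh K := Real.one_lt_cosh.mpr hK.ne'
  have key : ∀ X Y : ℝ, 0 < X → 0 < Y →
      Real.cosh K * (B₀ 0 0 ^ 2 * X + B₀ 1 1 ^ 2 / X + B₀ 1 0 ^ 2 * Y + B₀ 0 1 ^ 2 / Y) ≤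
      B₁ 0 0 ^ 2 * X + B₁ 1 1 ^ 2 / X + B₁ 1 0 ^ 2 * Y + B₁ 0 1 ^ 2 / Y := by
    intro X Y hX hY
    -- These parameters satisfy `exp (s - t) = X` and `exp (s + t) = Y`.
    have hd := h ((Real.log Y + Real.log X) / 2) ((Real.log Y - Real.log X) / 2)
    have e1 := two_cosh_dist_axisPt B₁ ((Real.log Y + Real.log X) / 2) ((Real.log Y - Real.log X) / 2)
    have e0 := two_cosh_dist_axisPt B₀ ((Real.log Y + Real.log X) / 2) ((Real.log Y - Real.log X) / 2)
    set d₁ := dist (mk B₁ • axisPt ((Real.log Y + Real.log X) / 2))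
      (axisPt ((Real.log Y - Real.log X) / 2))
    set d₀ := dist (mk B₀ • axisPt ((Real.log Y + Real.log X) / 2))
      (axisPt ((Real.log Y - Real.log X) / 2))
    have ex : (Real.log Y + Real.log X) / 2 - (Real.log Y - Real.log X) / 2 = Real.log X := by ring
    have ey : (Real.log Y + Real.log X) / 2 + (Real.log Y - Real.log X) / 2 = Real.log Y := by ring
    rw [ex, ey, Real.exp_log hX, Real.exp_log hY] at e1 e0
    rw [← e1, ← e0]
    have hd0 : 0 ≤ d₀ := dist_nonneg
    have h1 : Real.cosh (d₀ + K) ≤ Real.cosh d₁ := by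
      rw [Real.cosh_le_cosh, abs_of_nonneg (by linarith), abs_of_nonneg (by linarith)]
      linarith
    rw [Real.cosh_add] at h1
    have := mul_nonneg (Real.sinh_nonneg_iff.mpr hd0) (Real.sinh_nonneg_iff.mpr hK.le)
    linarith
  have d1 := det_entries B₁
  have d0 := det_entries B₀
  have e1 : (B₁ 0 0 * B₁ 1 1 - B₁ 0 1 * B₁ 1 0) ^ 2 = 1 := by rw [d1, one_pow]
  have e0 : (B₀ 0 0 * B₀ 1 1 - B₀ 0 1 * B₀ 1 0) ^ 2 = 1 := by rw [d0, one_pow]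
  rw [dominates_iff]
  refine ⟨⟨?_, ?_⟩, ?_, ?_⟩
  · refine abs_lt_abs_of_form_le hC (q₁ := B₁ 1 1) (r₁ := B₁ 1 0) (s₁ := B₁ 0 1) (q₀ := B₀ 1 1)
      (r₀ := B₀ 1 0) (s₀ := B₀ 0 1) (by linear_combination e1) (by linear_combination e0)
      fun X Y hX hY => ?_
    exact key X Y hX hY
  · refine abs_lt_abs_of_form_le hC (q₁ := B₁ 1 0) (r₁ := B₁ 0 0) (s₁ := B₁ 1 1) (q₀ := B₀ 1 0)
      (r₀ := B₀ 0 0) (s₀ := B₀ 1 1) (by linear_combination e1) (by linear_combination e0)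
      fun X Y hX hY => ?_
    have := key Y X⁻¹ hY (inv_pos.mpr hX)
    simp only [div_eq_mul_inv, inv_inv] at this ⊢
    linarith
  · refine abs_lt_abs_of_form_le hC (q₁ := B₁ 0 1) (r₁ := B₁ 0 0) (s₁ := B₁ 1 1) (q₀ := B₀ 0 1)
      (r₀ := B₀ 0 0) (s₀ := B₀ 1 1) (by linear_combination e1) (by linear_combination e0)
      fun X Y hX hY => ?_
    have := key Y X hY hX
    linarith
  · refine abs_lt_abs_of_form_le hC (q₁ := B₁ 0 0) (r₁ := B₁ 1 0) (s₁ := B₁ 0 1) (q₀ := B₀ 0 0)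
      (r₀ := B₀ 1 0) (s₀ := B₀ 0 1) (by linear_combination e1) (by linear_combination e0)
      fun X Y hX hY => ?_
    have := key X⁻¹ Y (inv_pos.mpr hX) hY
    simp only [div_eq_mul_inv, inv_inv] at this ⊢
    linarith

end HypPlane

namespace AdS

open HypPlane G0

/-! ### Intertwining elements of crooked planes -/

/-- Two elements of the crooked plane of the imaginary axis are intertwined by `b₁` and `b₀`. -/
def Intertwined (b₁ b₀ : G0) : Prop :=
  ∃ h ∈ crookedPlane axis, ∃ h' ∈ crookedPlane axis, b₁ * h = h' * b₀

theorem halfTurn_conj_mem {h : G0} (hh : h ∈ crookedPlane axis) :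
    mk halfTurn * h * (mk halfTurn)⁻¹ ∈ crookedPlane axis := by
  have := (crookedPlane_smul (mk halfTurn) axis h).mpr hh
  rwa [halfTurn_smul_axis] at this

/-- The half-turn preserves the crooked plane of the axis, so permuting matrix entries by it does
not affect intertwining; any entry can thus be brought to the lower left corner. -/
theorem Intertwined.of_mul_halfTurn {b₁ b₀ : G0}
    (H : Intertwined (b₁ * mk halfTurn) (b₀ * mk halfTurn)) : Intertwined b₁ b₀ := by
  obtain ⟨h, hh, h', hh', e⟩ := H
  refine ⟨_, halfTurn_conj_mem hh, h', hh', ?_⟩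
  rw [← mul_assoc] at e
  rw [← mul_assoc, ← mul_assoc, e]
  group

theorem Intertwined.of_halfTurn_mul {b₁ b₀ : G0}
    (H : Intertwined (mk halfTurn * b₁) (mk halfTurn * b₀)) : Intertwined b₁ b₀ := by
  obtain ⟨h, hh, h', hh', e⟩ := H
  have h1 := halfTurn_conj_mem hh'
  refine ⟨h, hh, _, h1, ?_⟩
  rw [mul_assoc] at e
  have e' : b₁ * h = (mk halfTurn)⁻¹ * (h' * (mk halfTurn * b₀)) := by rw [← e]; group
  rw [e', halfTurn_inv]
  simp only [mul_assoc]

theorem mem_crookedPlane_axis_of_upper {A : SL(2, ℝ)} (hc : A 1 0 = 0) (ha : 1 ≤ |A 0 0|) :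
    mk A ∈ crookedPlane axis :=
  ⟨OnePoint.infty, infty_mem_bar_axis, (isNonrepellingFixed_infty_iff A).mpr ⟨hc, ha⟩⟩

theorem toSphere_mem_bar {s : Set UpperHalfPlane} {z : UpperHalfPlane} (hz : z ∈ s) :
    toSphere z ∈ bar s :=
  subset_closure ⟨z, hz, rfl⟩

theorem mem_crookedPlane_of_fixed {l : Set UpperHalfPlane} {h : G0} {z : UpperHalfPlane}
    (hz : z ∈ l) (hh : h • z = z) : h ∈ crookedPlane l :=
  ⟨toSphere z, toSphere_mem_bar hz, isNonrepellingFixed_toSphere hh⟩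

/-- The upper triangular `A` is chosen so that `B₁ A` and `B₀` have the same second row. Then `B₁ A
B₀⁻¹` is upper triangular with diagonal entries 1, and `A` fixes `∞` nonrepellingly because its
upper left entry is `c₀ / c₁`. -/
theorem intertwined_of_corner {B₁ B₀ : SL(2, ℝ)} (h0 : B₁ 1 0 ≠ 0) (h : |B₁ 1 0| ≤ |B₀ 1 0|) :
    Intertwined (mk B₁) (mk B₀) := by
  have h0' : B₀ 1 0 ≠ 0 := by
    rw [← abs_pos] at h0 ⊢
    linarith
  have hdet := det_entries B₁
  set A : SL(2, ℝ) := ofEntries (B₀ 1 0 / B₁ 1 0)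
    ((B₀ 1 0 * B₀ 1 1 - B₁ 1 0 * B₁ 1 1) / (B₀ 1 0 * B₁ 1 0)) 0 (B₁ 1 0 / B₀ 1 0)
    (by field_simp; ring) with hA
  refine ⟨mk A, mem_crookedPlane_axis_of_upper rfl ?_, mk (B₁ * A * B₀⁻¹),
    mem_crookedPlane_axis_of_upper ?_ ?_, ?_⟩
  · rw [hA, ofEntries_00, abs_div, one_le_div (abs_pos.mpr h0)]
    exact h
  · simp [hA]
    field_simp
    ring
  · have : (B₁ * A * B₀⁻¹) 0 0 = 1 := by
      simp [hA]
      field_simp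
      linear_combination B₁ 1 0 * hdet
    rw [this, abs_one]
  · rw [← map_mul, ← map_mul]
    group

/-- Rotations about points at the same distance are intertwined. -/
theorem exists_fixed_intertwined {b₁ b₀ : G0} {x y : UpperHalfPlane}
    (h : dist (b₁ • x) y = dist (b₀ • x) y) :
    ∃ h h' : G0, h • x = x ∧ h' • y = y ∧ b₁ * h = h' * b₀ := by
  -- `h'` is a rotation about `y` carrying `b₀ • x` to `b₁ • x`; then `b₁⁻¹ h' b₀` fixes `x`.
  obtain ⟨h', hy, hx⟩ := exists_smul_eq_of_dist_eq (p := y) (z := b₀ • x) (w := b₁ • x)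
    (by rw [dist_comm, ← h, dist_comm])
  refine ⟨b₁⁻¹ * h' * b₀, h', ?_, hy, by group⟩
  rw [mul_smul, mul_smul, hx, inv_smul_smul]

theorem dist_lt_dist_of_form {B₁ B₀ : SL(2, ℝ)} {X Y : ℝ} (hX : 0 < X) (hY : 0 < Y)
    (h : B₀ 0 0 ^ 2 * X + B₀ 1 1 ^ 2 / X + B₀ 1 0 ^ 2 * Y + B₀ 0 1 ^ 2 / Y <
      B₁ 0 0 ^ 2 * X + B₁ 1 1 ^ 2 / X + B₁ 1 0 ^ 2 * Y + B₁ 0 1 ^ 2 / Y) :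
    ∃ p : ℝ × ℝ, dist (mk B₀ • axisPt p.1) (axisPt p.2) < dist (mk B₁ • axisPt p.1) (axisPt p.2) := by
  refine ⟨((Real.log Y + Real.log X) / 2, (Real.log Y - Real.log X) / 2), ?_⟩
  have e1 := two_cosh_dist_axisPt B₁ ((Real.log Y + Real.log X) / 2) ((Real.log Y - Real.log X) / 2)
  have e0 := two_cosh_dist_axisPt B₀ ((Real.log Y + Real.log X) / 2) ((Real.log Y - Real.log X) / 2)
  have ex : (Real.log Y + Real.log X) / 2 - (Real.log Y - Real.log X) / 2 = Real.log X := by ring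
  have ey : (Real.log Y + Real.log X) / 2 + (Real.log Y - Real.log X) / 2 = Real.log Y := by ring
  rw [ex, ey, Real.exp_log hX, Real.exp_log hY] at e1 e0
  rw [← e1, ← e0] at h
  rwa [mul_lt_mul_iff_right₀ two_pos, Real.cosh_lt_cosh, abs_of_nonneg dist_nonneg,
    abs_of_nonneg dist_nonneg] at h

/-- The difference of the two forms is positive for large `X`, because `|a₀| < |a₁|`, and negative
for large `Y`, because `c₁ = 0 ≠ c₀`. By continuity the distances agree at some pair of points of
the axis, and rotations about these points are intertwined. -/
theorem intertwined_of_zero_corner {B₁ B₀ : SL(2, ℝ)} (h1 : B₁ 1 0 = 0) (h0 : B₀ 1 0 ≠ 0)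
    (ha : |B₀ 0 0| < |B₁ 0 0|) : Intertwined (mk B₁) (mk B₀) := by
  have ha' := sub_pos.mpr (sq_lt_sq.mpr ha)
  have hc' := sq_pos_of_ne_zero h0
  obtain ⟨X, hX, hpos⟩ := exists_pos_of_leading_pos ha' (B₁ 1 1 ^ 2 - B₀ 1 1 ^ 2)
    (- B₀ 1 0 ^ 2 + B₁ 0 1 ^ 2 - B₀ 0 1 ^ 2)
  obtain ⟨Y, hY, hneg⟩ := exists_pos_of_leading_pos hc' (B₀ 0 1 ^ 2 - B₁ 0 1 ^ 2)
    (B₀ 0 0 ^ 2 + B₀ 1 1 ^ 2 - B₁ 0 0 ^ 2 - B₁ 1 1 ^ 2)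
  rw [sub_div] at hpos hneg
  obtain ⟨p, hp⟩ := dist_lt_dist_of_form (B₁ := B₁) (B₀ := B₀) hX one_pos (by
    rw [h1]; linarith)
  obtain ⟨q, hq⟩ := dist_lt_dist_of_form (B₁ := B₀) (B₀ := B₁) one_pos hY (by
    rw [h1]; linarith)
  have hcont : ∀ B : SL(2, ℝ), Continuous fun r : ℝ × ℝ =>
      dist (mk B • axisPt r.1) (axisPt r.2) := by
    intro B
    have := isometry_axisPt.continuous
    exact ((this.comp continuous_fst).const_smul (mk B)).dist (this.comp continuous_snd)
  obtain ⟨r, hr⟩ := mem_range_of_exists_le_of_exists_ge ((hcont B₁).sub (hcont B₀)) (c := 0)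
    ⟨q, by simp only [Pi.sub_apply]; linarith⟩ ⟨p, by simp only [Pi.sub_apply]; linarith⟩
  obtain ⟨h, h', hx, hy, e⟩ := exists_fixed_intertwined (sub_eq_zero.mp hr)
  exact ⟨h, mem_crookedPlane_of_fixed (axisPt_re _) hx, h',
    mem_crookedPlane_of_fixed (axisPt_re _) hy, e⟩

theorem corner_lt_of_not_intertwined {B₁ B₀ : SL(2, ℝ)} (H : ¬ Intertwined (mk B₁) (mk B₀)) :
    |B₀ 1 0| < |B₁ 1 0| := by
  by_contra! hle
  by_cases h1 : B₁ 1 0 = 0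
  · have hd1 := det_entries B₁
    have hd0 := det_entries B₀
    rw [h1, mul_zero, sub_zero] at hd1
    have ha : |B₀ 0 0| < |B₁ 0 0| := by
      by_contra! hle'
      refine H (Intertwined.of_halfTurn_mul ?_)
      rw [← map_mul, ← map_mul]
      apply intertwined_of_corner
      · simpa [halfTurn] using left_ne_zero_of_mul_eq_one hd1
      · simpa [halfTurn] using hle'
    have hd : |B₀ 1 1| < |B₁ 1 1| := by
      by_contra! hle'
      refine H (Intertwined.of_mul_halfTurn ?_)
      rw [← map_mul, ← map_mul]
      apply intertwined_of_corner
      · simpa [halfTurn] using right_ne_zero_of_mul_eq_one hd1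
      · simpa [halfTurn] using hle'
    -- If `c₀` vanished too, then `a₀ d₀ = 1 = a₁ d₁`, against the strict domination of both
    -- diagonal entries.
    refine H (intertwined_of_zero_corner h1 (fun h0 => ?_) ha)
    rw [h0, mul_zero, sub_zero] at hd0
    have := mul_lt_mul'' ha hd (abs_nonneg _) (abs_nonneg _)
    rw [← abs_mul, ← abs_mul, hd0, hd1] at this
    exact lt_irrefl _ this
  · exact H (intertwined_of_corner h1 hle)

theorem dominates_of_not_intertwined {B₁ B₀ : SL(2, ℝ)} (H : ¬ Intertwined (mk B₁) (mk B₀)) :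
    Dominates B₁ B₀ := by
  rw [dominates_iff]
  refine ⟨⟨?_, ?_⟩, corner_lt_of_not_intertwined H, ?_⟩
  · have := corner_lt_of_not_intertwined (B₁ := halfTurn * B₁) (B₀ := halfTurn * B₀) fun h =>
      H (Intertwined.of_halfTurn_mul (by rwa [← map_mul, ← map_mul]))
    simpa [halfTurn] using this
  · have := corner_lt_of_not_intertwined (B₁ := halfTurn * B₁ * halfTurn)
      (B₀ := halfTurn * B₀ * halfTurn) fun h =>
      H (Intertwined.of_halfTurn_mul (Intertwined.of_mul_halfTurn (by
        rwa [← map_mul, ← map_mul, ← map_mul, ← map_mul])))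
    simpa [halfTurn] using this
  · have := corner_lt_of_not_intertwined (B₁ := B₁ * halfTurn) (B₀ := B₀ * halfTurn) fun h =>
      H (Intertwined.of_mul_halfTurn (by rwa [← map_mul, ← map_mul]))
    simpa [halfTurn] using this

/-! ### Symmetric matrices attached to nonrepelling fixed points -/

/-- The symmetric matrix with entries `p`, `u`, `q`. -/
def symMatrix (p u q : ℝ) : Matrix (Fin 2) (Fin 2) ℝ := !![p, u; u, q]

/-- The symmetric matrix with entries `p`, `u`, `q` is expanded by `h`, up to a scalar. -/
def FixesForm (h : G0) (p u q : ℝ) : Prop :=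
  ∃ A : SL(2, ℝ), mk A = h ∧ ∃ κ : ℝ, 1 ≤ κ ∧
    A.1 * symMatrix p u q * A.1.transpose = κ • symMatrix p u q

/-- The polarization of the determinant of `2 × 2` matrices. -/
def detPairing (X Y : Matrix (Fin 2) (Fin 2) ℝ) : ℝ :=
  X 0 0 * Y 1 1 + X 1 1 * Y 0 0 - X 0 1 * Y 1 0 - X 1 0 * Y 0 1

/-- Polarization of `det (A X Aᵀ) = det X`. -/
theorem detPairing_conj (A : SL(2, ℝ)) (X Y : Matrix (Fin 2) (Fin 2) ℝ) :
    detPairing (A.1 * X * A.1.transpose) (A.1 * Y * A.1.transpose) = detPairing X Y := by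
  have hdet : A.1 0 0 * A.1 1 1 - A.1 0 1 * A.1 1 0 = 1 := det_entries A
  simp only [detPairing, Matrix.mul_apply, Fin.sum_univ_two, Matrix.transpose_apply]
  linear_combination (X 0 0 * Y 1 1 + X 1 1 * Y 0 0 - X 0 1 * Y 1 0 - X 1 0 * Y 0 1) *
    (A.1 0 0 * A.1 1 1 - A.1 0 1 * A.1 1 0 + 1) * hdet

theorem detPairing_smul_smul (κ κ' : ℝ) (X Y : Matrix (Fin 2) (Fin 2) ℝ) :
    detPairing (κ • X) (κ' • Y) = κ * κ' * detPairing X Y := by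
  simp [detPairing]
  ring

/-- The first bracket involves only squares of entries; the second collects the cross terms, which
vanish when `u = u' = 0`. -/
theorem detPairing_symMatrix (B : SL(2, ℝ)) (p u q p' u' q' : ℝ) :
    detPairing (B.1 * symMatrix p u q * B.1.transpose) (symMatrix p' u' q') =
      (p * q' * B 0 0 ^ 2 + q * q' * B 0 1 ^ 2 + p * p' * B 1 0 ^ 2 + q * p' * B 1 1 ^ 2) +
      (2 * u * (q' * (B 0 0 * B 0 1) + p' * (B 1 0 * B 1 1)) -
        2 * u' * (p * (B 0 0 * B 1 0) + q * (B 0 1 * B 1 1)) -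
        2 * u * u' * (B 0 0 * B 1 1 + B 0 1 * B 1 0)) := by
  simp [detPairing, symMatrix, Matrix.mul_apply, Fin.sum_univ_two]
  ring

/-- Apply both sides of `B₁ A = ± A' B₀` to the first matrix and pair with the second: `A`
contributes its factor, and invariance under `A'` contributes the other. The sign disappears because
the action is quadratic. -/
theorem FixesForm.detPairing_eq {B₁ B₀ : SL(2, ℝ)} {h h' : G0} {p u q p' u' q' : ℝ}
    (hh : FixesForm h p u q) (hh' : FixesForm h' p' u' q') (e : mk B₁ * h = h' * mk B₀) :
    ∃ κ : ℝ, 1 ≤ κ ∧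
      κ * detPairing (B₁.1 * symMatrix p u q * B₁.1.transpose) (symMatrix p' u' q') =
      detPairing (B₀.1 * symMatrix p u q * B₀.1.transpose) (symMatrix p' u' q') := by
  obtain ⟨A, rfl, κ, hκ, hA⟩ := hh
  obtain ⟨A', rfl, κ', hκ', hA'⟩ := hh'
  refine ⟨κ * κ', one_le_mul_of_one_le_of_one_le hκ hκ', ?_⟩
  rw [← detPairing_conj A' (B₀.1 * symMatrix p u q * B₀.1.transpose), hA', ← detPairing_smul_smul,
    ← Matrix.smul_mul, ← Matrix.mul_smul, ← hA]
  have key : B₁.1 * (A.1 * symMatrix p u q * A.1.transpose) * B₁.1.transpose =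
      A'.1 * (B₀.1 * symMatrix p u q * B₀.1.transpose) * A'.1.transpose := by
    rw [← map_mul, ← map_mul, mk_eq_mk_iff] at e
    have e' : B₁.1 * A.1 = A'.1 * B₀.1 ∨ B₁.1 * A.1 = -(A'.1 * B₀.1) := by
      rcases e with e | e
      · left; exact congrArg Subtype.val e
      · right; exact congrArg Subtype.val e
    have l : B₁.1 * (A.1 * symMatrix p u q * A.1.transpose) * B₁.1.transpose =
      (B₁.1 * A.1) * symMatrix p u q * (B₁.1 * A.1).transpose := by
      simp only [Matrix.transpose_mul, Matrix.mul_assoc]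
    have r : A'.1 * (B₀.1 * symMatrix p u q * B₀.1.transpose) * A'.1.transpose =
      (A'.1 * B₀.1) * symMatrix p u q * (A'.1 * B₀.1).transpose := by
      simp only [Matrix.transpose_mul, Matrix.mul_assoc]
    rw [l, r]
    rcases e' with e' | e' <;> rw [e']
    simp
  rw [key]

/-- Elements fixing forms cannot be intertwined when the entries are dominated. -/
theorem _root_.HypPlane.Dominates.not_intertwined_forms {B₁ B₀ : SL(2, ℝ)} (hD : Dominates B₁ B₀) {h h' : G0}
    {p u q p' u' q' : ℝ} (hh : FixesForm h p u q) (hh' : FixesForm h' p' u' q')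
    (hp : 0 ≤ p) (hq : 0 ≤ q) (hpq : 0 < p + q) (hp' : 0 ≤ p') (hq' : 0 ≤ q') (hpq' : 0 < p' + q')
    (hT : |2 * u * (q' * (B₀ 0 0 * B₀ 0 1) + p' * (B₀ 1 0 * B₀ 1 1)) -
        2 * u' * (p * (B₀ 0 0 * B₀ 1 0) + q * (B₀ 0 1 * B₀ 1 1)) -
        2 * u * u' * (B₀ 0 0 * B₀ 1 1 + B₀ 0 1 * B₀ 1 0)| ≤
      2 * u * (q' * (B₁ 0 0 * B₁ 0 1) + p' * (B₁ 1 0 * B₁ 1 1)) -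
        2 * u' * (p * (B₁ 0 0 * B₁ 1 0) + q * (B₁ 0 1 * B₁ 1 1)) -
        2 * u * u' * (B₁ 0 0 * B₁ 1 1 + B₁ 0 1 * B₁ 1 0)) :
    mk B₁ * h ≠ h' * mk B₀ := by
  intro e
  obtain ⟨κ, hκ, E⟩ := hh.detPairing_eq hh' e
  rw [detPairing_symMatrix, detPairing_symMatrix] at E
  have hT0 := (abs_nonneg _).trans hT
  have hT1 := (le_abs_self _).trans hT
  have hs : ∀ i j, B₀ i j ^ 2 < B₁ i j ^ 2 := fun i j => sq_lt_sq.mpr (hD i j)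
  -- All four coefficients are nonnegative and at least one product of a positive `p` or `q` with a
  -- positive `p'` or `q'` occurs.
  have hS : p * q' * B₀ 0 0 ^ 2 + q * q' * B₀ 0 1 ^ 2 + p * p' * B₀ 1 0 ^ 2 + q * p' * B₀ 1 1 ^ 2 <
      p * q' * B₁ 0 0 ^ 2 + q * q' * B₁ 0 1 ^ 2 + p * p' * B₁ 1 0 ^ 2 + q * p' * B₁ 1 1 ^ 2 := by
    have a1 := mul_nonneg (mul_nonneg hp hq') (sub_nonneg.mpr (hs 0 0).le)
    have a2 := mul_nonneg (mul_nonneg hq hq') (sub_nonneg.mpr (hs 0 1).le)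
    have a3 := mul_nonneg (mul_nonneg hp hp') (sub_nonneg.mpr (hs 1 0).le)
    have a4 := mul_nonneg (mul_nonneg hq hp') (sub_nonneg.mpr (hs 1 1).le)
    rcases hp.eq_or_lt with h1 | h1
    · have h2 : 0 < q := by linarith
      rcases hp'.eq_or_lt with h3 | h3
      · have h4 : 0 < q' := by linarith
        have := mul_pos (mul_pos h2 h4) (sub_pos.mpr (hs 0 1))
        linarith
      · have := mul_pos (mul_pos h2 h3) (sub_pos.mpr (hs 1 1))
        linarith
    · rcases hp'.eq_or_lt with h3 | h3
      · have h4 : 0 < q' := by linarith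
        have := mul_pos (mul_pos h1 h4) (sub_pos.mpr (hs 0 0))
        linarith
      · have := mul_pos (mul_pos h1 h3) (sub_pos.mpr (hs 1 0))
        linarith
  have hS0 : 0 ≤ p * q' * B₀ 0 0 ^ 2 + q * q' * B₀ 0 1 ^ 2 + p * p' * B₀ 1 0 ^ 2 +
    q * p' * B₀ 1 1 ^ 2 := by positivity
  set S1 := p * q' * B₁ 0 0 ^ 2 + q * q' * B₁ 0 1 ^ 2 + p * p' * B₁ 1 0 ^ 2 + q * p' * B₁ 1 1 ^ 2
  set T1 := 2 * u * (q' * (B₁ 0 0 * B₁ 0 1) + p' * (B₁ 1 0 * B₁ 1 1)) -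
        2 * u' * (p * (B₁ 0 0 * B₁ 1 0) + q * (B₁ 0 1 * B₁ 1 1)) -
        2 * u * u' * (B₁ 0 0 * B₁ 1 1 + B₁ 0 1 * B₁ 1 0)
  have : S1 + T1 ≤ κ * (S1 + T1) := le_mul_of_one_le_left (by linarith) hκ
  linarith

theorem fixesForm_infty {h : G0} (hh : IsNonrepellingFixed h OnePoint.infty) :
    FixesForm h 1 0 0 := by
  obtain ⟨A, rfl⟩ := mk_surjective h
  obtain ⟨hc, ha⟩ := (isNonrepellingFixed_infty_iff A).mp hh
  have hc' : A.1 1 0 = 0 := hc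
  refine ⟨A, rfl, A 0 0 ^ 2, one_le_sq_iff_one_le_abs _ |>.mpr ha, ?_⟩
  ext i j
  fin_cases i <;> fin_cases j <;>
    simp [symMatrix, Matrix.mul_apply, Fin.sum_univ_two, hc']
  ring

/-- The matrix is the real part of `v v*` with `v = (z, 1)`. At a fixed point `A v = (c z + d) v`,
so the factor is `|c z + d|²`, which is at least 1 exactly when the fixed point is nonrepelling. -/
theorem fixesForm_coe {h : G0} {z : ℂ} (hz : 0 ≤ z.im)
    (hh : IsNonrepellingFixed h (z : OnePoint ℂ)) : FixesForm h (Complex.normSq z) z.re 1 := by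
  obtain ⟨A, rfl⟩ := mk_surjective h
  obtain ⟨e, hn⟩ := (isNonrepellingFixed_coe_iff A z hz).mp hh
  refine ⟨A, rfl, _, hn, ?_⟩
  have e1 := congrArg Complex.re e
  have e2 := congrArg Complex.im e
  have d : A 0 0 * A 1 1 - A 0 1 * A 1 0 = 1 := det_entries A
  simp at e1 e2
  have key1 : Complex.normSq ((A 0 0 : ℂ) * z + A 0 1) =
      Complex.normSq z * Complex.normSq ((A 1 0 : ℂ) * z + A 1 1) := by rw [e, map_mul]
  ext i j
  fin_cases i <;> fin_cases j <;>
    simp [symMatrix, Matrix.mul_apply, Fin.sum_univ_two, Complex.normSq_apply] at key1 ⊢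
  · linear_combination key1
  · linear_combination (A 1 0 * z.re + A 1 1) * e1 + A 1 0 * z.im * e2
  · linear_combination (A 1 0 * z.re + A 1 1) * e1 + A 1 0 * z.im * e2
  · ring

theorem exists_fixesForm_of_mem_crookedPlane {h : G0} (hh : h ∈ crookedPlane axis) :
    ∃ p q : ℝ, 0 ≤ p ∧ 0 ≤ q ∧ 0 < p + q ∧ FixesForm h p 0 q := by
  obtain ⟨x, hx, hh⟩ := hh
  induction x using OnePoint.rec with
  | infty => exact ⟨1, 0, zero_le_one, le_rfl, by norm_num, fixesForm_infty hh⟩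
  | coe z =>
    obtain ⟨h1, h2⟩ := coe_mem_bar_axis.mp hx
    have := fixesForm_coe h2 hh
    rw [h1] at this
    have h3 := Complex.normSq_nonneg z
    exact ⟨_, 1, h3, zero_le_one, by linarith, this⟩

theorem _root_.HypPlane.Dominates.not_intertwined {B₁ B₀ : SL(2, ℝ)} (hD : Dominates B₁ B₀) :
    ¬ Intertwined (mk B₁) (mk B₀) := by
  rintro ⟨h, hh, h', hh', e⟩
  obtain ⟨p, q, hp, hq, hpq, hF⟩ := exists_fixesForm_of_mem_crookedPlane hh
  obtain ⟨p', q', hp', hq', hpq', hF'⟩ := exists_fixesForm_of_mem_crookedPlane hh'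
  exact hD.not_intertwined_forms hF hF' hp hq hpq hp' hq' hpq' (by simp) e

end AdS

/-! ### Limits of the difference of distances at the endpoints -/

namespace HypPlane

open G0

/-- Pairs of points of the plane tending to the pair `(∞, ∞)` of boundary points. -/
noncomputable def atInfty : Filter (UpperHalfPlane × UpperHalfPlane) :=
  comap (Prod.map toSphere toSphere) (𝓝 (OnePoint.infty, OnePoint.infty))

instance : atInfty.NeBot := by
  have h : Tendsto (fun n : ℕ => toSphere (axisPt n)) atTop (𝓝 OnePoint.infty) := by
    apply tendsto_coe_infty
    refine tendsto_atTop_mono (fun n => ?_) tendsto_natCast_atTop_atTop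
    have h1 : (n : ℝ) ≤ (axisPt n).im := by
      rw [axisPt_im]
      linarith [Real.add_one_le_exp (n : ℝ)]
    exact h1.trans ((le_abs_self _).trans (Complex.abs_im_le_norm _))
  have h2 : Tendsto (fun n : ℕ => (axisPt n, axisPt n)) atTop atInfty := by
    rw [atInfty, tendsto_comap_iff, nhds_prod_eq]
    exact h.prodMk h
  exact h2.neBot

theorem tendsto_norm_of_tendsto_toSphere {α : Type*} {F : Filter α} {f : α → UpperHalfPlane}
    (h : Tendsto (fun x => toSphere (f x)) F (𝓝 OnePoint.infty)) :
    Tendsto (fun x => ‖(f x : ℂ)‖) F atTop := by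
  have h1 : Tendsto (fun x => (f x : ℂ)) F (comap ((↑) : ℂ → OnePoint ℂ) (𝓝 OnePoint.infty)) :=
    tendsto_comap_iff.mpr h
  rw [OnePoint.comap_coe_nhds_infty, coclosedCompact_eq_cocompact, ← Metric.cobounded_eq_cocompact]
    at h1
  exact tendsto_norm_atTop_iff_cobounded.mpr h1

theorem tendsto_toSphere_atInfty :
    Tendsto (fun p : UpperHalfPlane × UpperHalfPlane => toSphere p.1) atInfty (𝓝 OnePoint.infty) ∧
    Tendsto (fun p : UpperHalfPlane × UpperHalfPlane => toSphere p.2) atInfty (𝓝 OnePoint.infty) := by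
  have h : Tendsto (Prod.map toSphere toSphere) atInfty
    (𝓝 (OnePoint.infty, OnePoint.infty)) := tendsto_comap
  rw [nhds_prod_eq, tendsto_prod_iff'] at h
  exact h

/-- The quantity to which `exp (dist x y / 2)` is compared when `x` and `y` tend to infinity. -/
noncomputable def scale (p : UpperHalfPlane × UpperHalfPlane) : ℝ :=
  ‖(p.1 : ℂ)‖ * ‖(p.2 : ℂ)‖ / (2 * √(p.1.im * p.2.im))

theorem scale_pos (p : UpperHalfPlane × UpperHalfPlane) : 0 < scale p := by
  have h1 := norm_pos_iff.mpr (UpperHalfPlane.ne_zero p.1)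
  have h2 := norm_pos_iff.mpr (UpperHalfPlane.ne_zero p.2)
  have h3 := Real.sqrt_pos.mpr (mul_pos p.1.im_pos p.2.im_pos)
  unfold scale
  positivity

theorem tendsto_scale : Tendsto scale atInfty atTop := by
  have h1 := tendsto_norm_of_tendsto_toSphere tendsto_toSphere_atInfty.1
  have h2 := tendsto_norm_of_tendsto_toSphere tendsto_toSphere_atInfty.2
  have h3 : Tendsto (fun p : UpperHalfPlane × UpperHalfPlane => √(‖(p.1 : ℂ)‖ * ‖(p.2 : ℂ)‖) / 2)
      atInfty atTop :=
    (Real.tendsto_sqrt_atTop.comp (h1.atTop_mul_atTop₀ h2)).atTop_div_const two_pos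
  refine tendsto_atTop_mono (fun p => ?_) h3
  have p1 := norm_pos_iff.mpr (UpperHalfPlane.ne_zero p.1)
  have p2 := norm_pos_iff.mpr (UpperHalfPlane.ne_zero p.2)
  have h4 : p.1.im * p.2.im ≤ ‖(p.1 : ℂ)‖ * ‖(p.2 : ℂ)‖ :=
    mul_le_mul ((le_abs_self _).trans (Complex.abs_im_le_norm _))
      ((le_abs_self _).trans (Complex.abs_im_le_norm _)) p.2.im_pos.le (norm_nonneg _)
  have h5 := Real.sqrt_le_sqrt h4
  have h6 := Real.sqrt_pos.mpr (mul_pos p.1.im_pos p.2.im_pos)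
  have h7 : ‖(p.1 : ℂ)‖ * ‖(p.2 : ℂ)‖ =
      √(‖(p.1 : ℂ)‖ * ‖(p.2 : ℂ)‖) * √(‖(p.1 : ℂ)‖ * ‖(p.2 : ℂ)‖) :=
    (Real.mul_self_sqrt (by positivity)).symm
  unfold scale
  rw [div_le_div_iff₀ two_pos (by positivity)]
  nlinarith [Real.sqrt_nonneg (‖(p.1 : ℂ)‖ * ‖(p.2 : ℂ)‖)]

/-- One has `sinh (d / 2) = m · scale` with `m` tending to `|c|`; as `exp = sinh + cosh`, the
quotient is `m + √(scale⁻² + m²)`. -/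
theorem tendsto_exp_half_dist_div_scale (B : SL(2, ℝ)) :
    Tendsto (fun p => Real.exp (dist (mk B • p.1) p.2 / 2) / scale p) atInfty
      (𝓝 (2 * |B 1 0|)) := by
  have i1 : Tendsto (fun p : UpperHalfPlane × UpperHalfPlane => (p.1 : ℂ)⁻¹) atInfty (𝓝 0) :=
    tendsto_inv₀_cobounded.comp (tendsto_norm_atTop_iff_cobounded.mp
      (tendsto_norm_of_tendsto_toSphere tendsto_toSphere_atInfty.1))
  have i2 : Tendsto (fun p : UpperHalfPlane × UpperHalfPlane => (p.2 : ℂ)⁻¹) atInfty (𝓝 0) :=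
    tendsto_inv₀_cobounded.comp (tendsto_norm_atTop_iff_cobounded.mp
      (tendsto_norm_of_tendsto_toSphere tendsto_toSphere_atInfty.2))
  have hM : Tendsto (fun p : UpperHalfPlane × UpperHalfPlane =>
      ‖(B 0 0 : ℂ) * (p.2 : ℂ)⁻¹ + B 0 1 * ((p.1 : ℂ)⁻¹ * (p.2 : ℂ)⁻¹) - B 1 0 -
        B 1 1 * (p.1 : ℂ)⁻¹‖) atInfty (𝓝 |B 1 0|) := by
    have := ((((i2.const_mul (B 0 0 : ℂ)).add ((i1.mul i2).const_mul (B 0 1 : ℂ))).sub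
      (tendsto_const_nhds (x := (B 1 0 : ℂ)))).sub (i1.const_mul (B 1 1 : ℂ))).norm
    simpa using this
  have hr : Tendsto (fun p => (scale p)⁻¹) atInfty (𝓝 0) :=
    tendsto_inv_atTop_zero.comp tendsto_scale
  have hlim := hM.add ((Real.continuous_sqrt.tendsto _).comp ((hr.pow 2).add (hM.pow 2)))
  have e : |B 1 0| + √((0 : ℝ) ^ 2 + |B 1 0| ^ 2) = 2 * |B 1 0| := by
    rw [zero_pow two_ne_zero, zero_add, Real.sqrt_sq (abs_nonneg _)]
    ring
  rw [e] at hlim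
  refine hlim.congr fun p => ?_
  have h1 := UpperHalfPlane.ne_zero p.1
  have h2 := UpperHalfPlane.ne_zero p.2
  have hs := scale_pos p
  set m := ‖(B 0 0 : ℂ) * (p.2 : ℂ)⁻¹ + B 0 1 * ((p.1 : ℂ)⁻¹ * (p.2 : ℂ)⁻¹) - B 1 0 -
        B 1 1 * (p.1 : ℂ)⁻¹‖ with hm
  have hsinh : Real.sinh (dist (mk B • p.1) p.2 / 2) = m * scale p := by
    rw [sinh_half_dist_mk_smul, hm, scale, mul_div_assoc', ← norm_mul, ← norm_mul]
    congr 2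
    field_simp
    ring
  have hcosh : Real.cosh (dist (mk B • p.1) p.2 / 2) = √(1 + (m * scale p) ^ 2) := by
    rw [← hsinh, add_comm, ← Real.cosh_sq, Real.sqrt_sq (Real.cosh_pos _).le]
  rw [← Real.cosh_add_sinh, hsinh, hcosh, add_div, mul_div_cancel_right₀ _ hs.ne', add_comm]
  congr 1
  simp only [Function.comp]
  rw [eq_div_iff hs.ne']
  nth_rw 2 [← Real.sqrt_sq hs.le]
  rw [← Real.sqrt_mul (by positivity)]
  congr 1
  rw [← hm]
  field_simp

/-- The extension to `(∞, ∞)` of the difference of distances is positive if and only if the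
lower left entries satisfy a strict inequality. -/
theorem corner_lt_iff (B₁ B₀ : SL(2, ℝ)) :
    (B₁ 1 0 ≠ 0 ∧ ∃ L : EReal, Tendsto (fun p : UpperHalfPlane × UpperHalfPlane =>
      ((dist (mk B₁ • p.1) p.2 - dist (mk B₀ • p.1) p.2 : ℝ) : EReal)) atInfty (𝓝 L) ∧ 0 < L) ↔
    |B₀ 1 0| < |B₁ 1 0| := by
  set f : UpperHalfPlane × UpperHalfPlane → ℝ :=
    fun p => dist (mk B₁ • p.1) p.2 - dist (mk B₀ • p.1) p.2 with hf
  have hexp : B₁ 1 0 ≠ 0 → Tendsto (fun p => Real.exp (-(f p) / 2)) atInfty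
      (𝓝 (|B₀ 1 0| / |B₁ 1 0|)) := by
    intro h
    have := (tendsto_exp_half_dist_div_scale B₀).div (tendsto_exp_half_dist_div_scale B₁)
      (by simpa using h)
    rw [mul_div_mul_left _ _ two_ne_zero] at this
    refine this.congr fun p => ?_
    simp only [Pi.div_apply]
    rw [div_div_div_cancel_right₀ (scale_pos p).ne', ← Real.exp_sub, hf]
    congr 1
    ring
  have hpos : B₁ 1 0 ≠ 0 → B₀ 1 0 ≠ 0 → Tendsto (fun p => (f p : EReal)) atInfty
      (𝓝 ((-2 * Real.log (|B₀ 1 0| / |B₁ 1 0|) : ℝ) : EReal)) := by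
    intro h1 h0
    rw [EReal.tendsto_coe]
    have h2 : |B₀ 1 0| / |B₁ 1 0| ≠ 0 := by simp [h0, h1]
    refine (((Real.continuousAt_log h2).tendsto.comp (hexp h1)).const_mul (-2)).congr fun p => ?_
    simp only [Function.comp, Real.log_exp]
    ring
  constructor
  · rintro ⟨h1, L, hL, hL0⟩
    by_cases h0 : B₀ 1 0 = 0
    · rw [h0, abs_zero]
      exact abs_pos.mpr h1
    · have e := tendsto_nhds_unique hL (hpos h1 h0)
      rw [e, EReal.coe_pos] at hL0
      have h3 : Real.log (|B₀ 1 0| / |B₁ 1 0|) < 0 := by linarith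
      have h4 : |B₀ 1 0| / |B₁ 1 0| < 1 := by
        by_contra! h
        exact absurd (Real.log_nonneg h) (not_le.mpr h3)
      rwa [div_lt_one (abs_pos.mpr h1)] at h4
  · intro h
    have h1 : B₁ 1 0 ≠ 0 := abs_pos.mp ((abs_nonneg _).trans_lt h)
    refine ⟨h1, ?_⟩
    -- When `c₀ = 0` the limit is `+∞`, since `exp (-f / 2)` tends to 0.
    by_cases h0 : B₀ 1 0 = 0
    · refine ⟨⊤, ?_, EReal.zero_lt_top⟩
      rw [EReal.tendsto_coe_nhds_top_iff]
      have := hexp h1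
      rw [h0, abs_zero, zero_div, Real.tendsto_exp_comp_nhds_zero] at this
      refine ((tendsto_neg_atBot_atTop.comp this).const_mul_atTop two_pos).congr fun p => ?_
      simp only [Function.comp]
      ring
    · refine ⟨_, hpos h1 h0, ?_⟩
      rw [EReal.coe_pos]
      have h2 := abs_pos.mpr h0
      have h3 := abs_pos.mpr h1
      have := Real.log_neg (div_pos h2 h3) ((div_lt_one h3).mpr h)
      linarith

theorem extDistDiff_smul_iff (g g' k k' : G0) (ξ ξ' : OnePoint ℂ) (L : EReal) :
    ExtDistDiff g g' (k • ξ) (k' • ξ') L ↔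
      Tendsto (fun p : UpperHalfPlane × UpperHalfPlane =>
        ((dist (((g' * k')⁻¹ * (g * k)) • p.1) p.2 - dist ((k'⁻¹ * k) • p.1) p.2 : ℝ) : EReal))
        (comap (Prod.map toSphere toSphere) (𝓝 (ξ, ξ'))) (𝓝 L) := by
  unfold ExtDistDiff
  set e : UpperHalfPlane × UpperHalfPlane ≃ₜ UpperHalfPlane × UpperHalfPlane :=
    (Homeomorph.smul k).prodCongr (Homeomorph.smul k') with he
  set E : OnePoint ℂ × OnePoint ℂ ≃ₜ OnePoint ℂ × OnePoint ℂ :=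
    (Homeomorph.smul k).prodCongr (Homeomorph.smul k') with hE
  have hcomm : Prod.map toSphere toSphere ∘ e = E ∘ Prod.map toSphere toSphere := by
    ext1 p
    exact Prod.ext (toSphere_smul k p.1) (toSphere_smul k' p.2)
  have hfil : comap e (comap (Prod.map toSphere toSphere) (𝓝 (k • ξ, k' • ξ'))) =
      comap (Prod.map toSphere toSphere) (𝓝 (ξ, ξ')) := by
    rw [comap_comap, hcomm, ← comap_comap, E.comap_nhds_eq]
    congr 2
    exact E.symm_apply_apply (ξ, ξ')
  rw [← hfil, ← map_comap_of_surjective e.surjective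
    (comap (Prod.map toSphere toSphere) (𝓝 (k • ξ, k' • ξ'))), tendsto_map'_iff,
    comap_map e.injective]
  refine tendsto_congr fun p => ?_
  simp only [Function.comp, distDiff, he]
  congr 2
  · rw [← dist_smul (g' * k') (((g' * k')⁻¹ * (g * k)) • p.1), mul_smul _ (g * k), smul_inv_smul,
      mul_smul, mul_smul]
    rfl
  · rw [← dist_smul k' ((k'⁻¹ * k) • p.1), mul_smul _ k, smul_inv_smul]
    rfl

/-- That the two image endpoints differ means that `B₁` does not fix `∞`, i.e. that its lower left
entry is nonzero. -/
theorem endpoint_condition_iff (G G' K K' : SL(2, ℝ)) :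
    (mk G • mk K • (OnePoint.infty : OnePoint ℂ) ≠ mk G' • mk K' • (OnePoint.infty : OnePoint ℂ) ∧
      ∃ L : EReal, ExtDistDiff (mk G) (mk G') (mk K • OnePoint.infty) (mk K' • OnePoint.infty) L ∧
        0 < L) ↔ |(K'⁻¹ * K) 1 0| < |((G' * K')⁻¹ * (G * K)) 1 0| := by
  rw [← corner_lt_iff]
  refine and_congr ?_ ?_
  · refine not_congr ?_
    rw [← mul_smul, ← mul_smul, ← inv_smul_eq_iff, ← mul_smul, ← map_mul, ← map_mul, ← map_inv,
      ← map_mul, mk_smul_infty]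
    split_ifs with h
    · exact iff_of_true rfl h
    · exact iff_of_false (OnePoint.coe_ne_infty _) h
  · simp only [extDistDiff_smul_iff, atInfty, map_mul, map_inv]

theorem endpoint_conditions_iff_dominates (G G' K K' : SL(2, ℝ)) :
    (∀ ξ ∈ endpoints (mk K • axis), ∀ ξ' ∈ endpoints (mk K' • axis),
      mk G • ξ ≠ mk G' • ξ' ∧ ∃ L : EReal, ExtDistDiff (mk G) (mk G') ξ ξ' L ∧ 0 < L) ↔
    Dominates ((G' * K')⁻¹ * (G * K)) (K'⁻¹ * K) := by
  have hend : ∀ K : SL(2, ℝ), endpoints (mk K • axis) =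
      {mk K • OnePoint.infty, mk (K * halfTurn) • OnePoint.infty} := by
    intro K
    rw [endpoints_smul, endpoints_axis, ← halfTurn_smul_infty, map_mul, mul_smul]
    simp [← Set.image_smul, Set.image_insert_eq]
  simp only [hend, Set.mem_insert_iff, Set.mem_singleton_iff, forall_eq_or_imp, forall_eq,
    endpoint_condition_iff, dominates_iff]
  -- The second endpoint is reached by composing with the half-turn, which exchanges rows or columns
  -- up to sign.
  have e1 : ∀ A B : SL(2, ℝ), ∀ j, |((A * halfTurn)⁻¹ * B) 1 j| = |(A⁻¹ * B) 0 j| := by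
    intro A B j
    rw [mul_inv_rev, mul_assoc, mul_entry]
    simp [halfTurn, -mul_entry]
  have e2 : ∀ A B : SL(2, ℝ), ∀ i, |(A * (B * halfTurn)) i 0| = |(A * B) i 1| := by
    intro A B i
    rw [← mul_assoc, mul_entry]
    simp [halfTurn, -mul_entry]
  simp only [← mul_assoc G' K' halfTurn, ← mul_assoc G K halfTurn, e1, e2]
  tauto

end HypPlane

/-! ### Transfer to arbitrary lines, and disjoint closures -/

namespace AdS

open HypPlane G0

theorem disjoint_smul_iff {S S₀ S' S₀' : Set G0} {g g' k k' : G0}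
    (hS : ∀ h, k * h * k⁻¹ ∈ S ↔ h ∈ S₀) (hS' : ∀ h, k' * h * k'⁻¹ ∈ S' ↔ h ∈ S₀') :
    Disjoint (g • S) (g' • S') ↔
      ∀ h ∈ S₀, ∀ h' ∈ S₀', (g' * k')⁻¹ * (g * k) * h ≠ h' * (k'⁻¹ * k) := by
  rw [Set.disjoint_left]
  constructor
  · intro H h hh h' hh' e
    refine H (Set.smul_mem_smul_set ((hS h).mpr hh)) ⟨_, (hS' h').mpr hh', ?_⟩
    simp only [smul_eq_mul]
    have : g * k * h = g' * k' * (h' * (k'⁻¹ * k)) := by rw [← e]; group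
    calc g' * (k' * h' * k'⁻¹) = g' * k' * (h' * (k'⁻¹ * k)) * k⁻¹ := by group
      _ = g * (k * h * k⁻¹) := by rw [← this]; group
  · rintro H _ ⟨s, hs, rfl⟩ ⟨s', hs', e⟩
    have e' : g' * s' = g * s := e
    refine H (k⁻¹ * s * k) ((hS _).mp (by convert hs using 1; group)) (k'⁻¹ * s' * k')
      ((hS' _).mp (by convert hs' using 1; group)) ?_
    calc (g' * k')⁻¹ * (g * k) * (k⁻¹ * s * k) = k'⁻¹ * g'⁻¹ * (g * s) * k := by group
      _ = k'⁻¹ * s' * k' * (k'⁻¹ * k) := by rw [← e']; group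

theorem disjoint_crookedPlane_iff (G G' K K' : SL(2, ℝ)) :
    Disjoint (mk G • crookedPlane (mk K • axis)) (mk G' • crookedPlane (mk K' • axis)) ↔
      Dominates ((G' * K')⁻¹ * (G * K)) (K'⁻¹ * K) := by
  rw [disjoint_smul_iff (crookedPlane_smul (mk K) axis) (crookedPlane_smul (mk K') axis)]
  have e : Dominates ((G' * K')⁻¹ * (G * K)) (K'⁻¹ * K) ↔
      ¬ Intertwined (mk ((G' * K')⁻¹ * (G * K))) (mk (K'⁻¹ * K)) :=
    ⟨fun h => h.not_intertwined, dominates_of_not_intertwined⟩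
  rw [e]
  simp only [Intertwined, map_mul, map_inv, not_exists, not_and]

theorem uniform_gap_iff_dominates (G G' K K' : SL(2, ℝ)) :
    (∃ C : ℝ, 0 < C ∧ ∀ x ∈ mk K • axis, ∀ x' ∈ mk K' • axis,
      C ≤ dist (mk G • x) (mk G' • x') - dist x x') ↔
      Dominates ((G' * K')⁻¹ * (G * K)) (K'⁻¹ * K) := by
  have key : ∀ s t, dist (mk G • mk K • axisPt s) (mk G' • mk K' • axisPt t) -
      dist (mk K • axisPt s) (mk K' • axisPt t) =
      dist (mk ((G' * K')⁻¹ * (G * K)) • axisPt s) (axisPt t) -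
      dist (mk (K'⁻¹ * K) • axisPt s) (axisPt t) := by
    intro s t
    rw [← dist_smul (mk (G' * K')) (mk ((G' * K')⁻¹ * (G * K)) • axisPt s),
      ← dist_smul (mk K') (mk (K'⁻¹ * K) • axisPt s), ← mul_smul, ← mul_smul, ← mul_smul,
      ← mul_smul, ← map_mul, ← map_mul, ← map_mul, ← map_mul]
    simp only [mul_inv_cancel_left]
  constructor
  · rintro ⟨C, hC, H⟩
    refine dominates_of_uniform_gap hC fun s t => ?_
    rw [← key]
    exact H _ (Set.smul_mem_smul_set (axisPt_re s)) _ (Set.smul_mem_smul_set (axisPt_re t))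
  · intro h
    obtain ⟨C, hC, H⟩ := h.exists_uniform_gap
    refine ⟨C, hC, ?_⟩
    rintro _ ⟨x, hx, rfl⟩ _ ⟨x', hx', rfl⟩
    rw [eq_axisPt hx, eq_axisPt hx']
    exact (H _ _).trans_eq (key _ _).symm

theorem _root_.HypPlane.Dominates.lt_dist {B₁ B₀ : SL(2, ℝ)} (hD : Dominates B₁ B₀)
    {x y : UpperHalfPlane} (hx : x ∈ axis) (hy : y ∈ axis) :
    dist (mk B₀ • x) y < dist (mk B₁ • x) y := by
  obtain ⟨K, hK, h⟩ := hD.exists_uniform_gap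
  rw [eq_axisPt hx, eq_axisPt hy]
  linarith [h (Real.log x.im) (Real.log y.im)]

/-- The entries of `B₁` are nonzero, so no endpoint of the axis is sent to an endpoint. A crossing
inside the plane would be a pair at distance 0, yet this distance must exceed the one for `B₀`. -/
theorem _root_.HypPlane.Dominates.disjoint_bar {B₁ B₀ : SL(2, ℝ)} (hD : Dominates B₁ B₀) :
    Disjoint (mk B₁ • bar axis) (bar axis) := by
  have hne : ∀ i j, B₁ i j ≠ 0 := fun i j => abs_pos.mp ((abs_nonneg _).trans_lt (hD i j))
  rw [Set.disjoint_left]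
  rintro _ ⟨x, hx, rfl⟩ hmem
  induction x using OnePoint.rec with
  | infty =>
    simp only [mk_smul_infty, if_neg (hne 1 0)] at hmem
    have := (coe_mem_bar_axis.mp hmem).1
    norm_cast at this
    exact div_ne_zero (hne 0 0) (hne 1 0) this
  | coe z =>
    obtain ⟨h1, h2⟩ := coe_mem_bar_axis.mp hx
    rcases h2.eq_or_lt with h3 | h3
    · have hz : z = 0 := Complex.ext h1 h3.symm
      subst hz
      simp [mk_smul_coe, hne 1 1] at hmem
      have := (coe_mem_bar_axis.mp hmem).1
      norm_cast at this
      exact div_ne_zero (hne 0 1) (hne 1 1) this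
    · lift z to UpperHalfPlane using h3
      have e : mk B₁ • ((z : ℂ) : OnePoint ℂ) = ((mk B₁ • z : UpperHalfPlane) : ℂ) :=
        (toSphere_smul (mk B₁) z).symm
      simp only [e] at hmem
      have := hD.lt_dist (x := z) h1 (y := mk B₁ • z) (coe_mem_bar_axis.mp hmem).1
      rw [dist_self] at this
      exact absurd dist_nonneg (not_le.mpr this)

theorem disjoint_bar_of_dominates (G G' K K' : SL(2, ℝ))
    (hD : Dominates ((G' * K')⁻¹ * (G * K)) (K'⁻¹ * K)) :
    Disjoint (bar (mk G • mk K • axis)) (bar (mk G' • mk K' • axis)) := by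
  have := hD.disjoint_bar
  replace this := (Set.disjoint_image_iff (MulAction.injective (mk (G' * K')))).mpr this
  rw [Set.image_smul, Set.image_smul, ← mul_smul, ← map_mul, mul_inv_cancel_left] at this
  simpa only [bar_smul, map_mul, mul_smul] using this

end AdS

/-! ### The closed half-space contains the crooked plane -/

namespace AdS

open HypPlane G0

theorem coe_mem_bar_rightHalf_sdiff {z : ℂ} :
    (z : OnePoint ℂ) ∈ bar rightHalf \ bar axis ↔ 0 < z.re ∧ 0 ≤ z.im := by
  rw [Set.mem_sdiff, coe_mem_bar_axis, coe_mem_bar_rightHalf]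
  constructor
  · rintro ⟨⟨h1, h2⟩, h3⟩
    exact ⟨lt_of_le_of_ne h1 fun h => h3 ⟨h.symm, h2⟩, h2⟩
  · rintro ⟨h1, h2⟩
    exact ⟨⟨h1.le, h2⟩, fun h => h1.ne' h.1⟩

/-- The translation of length `2 ε` along the geodesic from `-1` to `1`, lifted to `SL(2, ℝ)`. -/
noncomputable def translation (ε : ℝ) : SL(2, ℝ) :=
  ofEntries (Real.cosh ε) (Real.sinh ε) (Real.sinh ε) (Real.cosh ε) (by
    rw [← sq, ← sq, Real.cosh_sq_sub_sinh_sq])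

theorem tendsto_translation : Tendsto (fun ε => mk (translation ε)) (𝓝[>] 0) (𝓝 1) := by
  have h1 : Continuous translation := by
    refine Continuous.subtype_mk ?_ _
    refine continuous_matrix fun i j => ?_
    fin_cases i <;> fin_cases j <;> simp <;> fun_prop
  have h2 : translation 0 = 1 := by
    apply ext_entries <;> simp [translation]
  have h3 := (isOpenQuotientMap_mk.continuous.comp h1).tendsto 0
  simp only [Function.comp, h2, map_one] at h3
  exact tendsto_nhdsWithin_of_tendsto_nhds h3

/-- A translation perpendicular to the axis pushes the whole closed axis, endpoints included,
strictly to the positive side; for example `∞` goes to `coth ε`. -/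
theorem translation_smul_mem {ε : ℝ} (hε : 0 < ε) {x : OnePoint ℂ} (hx : x ∈ bar axis) :
    mk (translation ε) • x ∈ bar rightHalf \ bar axis := by
  have hs := Real.sinh_pos_iff.mpr hε
  have hc := Real.cosh_pos ε
  have hcs := Real.cosh_sq_sub_sinh_sq ε
  induction x using OnePoint.rec with
  | infty =>
    rw [mk_smul_infty, if_neg (show ¬ translation ε 1 0 = 0 from hs.ne')]
    simp only [translation, ofEntries_00, ofEntries_10]
    rw [← Complex.ofReal_div, coe_mem_bar_rightHalf_sdiff]
    exact ⟨by rw [Complex.ofReal_re]; positivity, by rw [Complex.ofReal_im]⟩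
  | coe z =>
    obtain ⟨h1, h2⟩ := coe_mem_bar_axis.mp hx
    have hne : (translation ε 1 0 : ℂ) * z + translation ε 1 1 ≠ 0 := by
      intro h
      have := congrArg Complex.re h
      simp [-Complex.ofReal_sinh, -Complex.ofReal_cosh, translation, h1] at this
      exact hc.ne' this
    have hn := Complex.normSq_pos.mpr hne
    rw [mk_smul_coe, if_neg hne, coe_mem_bar_rightHalf_sdiff, Complex.div_re, Complex.div_im,
      ← add_div, ← sub_div]
    constructor
    · apply div_pos _ hn
      simp [-Complex.ofReal_sinh, -Complex.ofReal_cosh, translation, h1]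
      have := mul_pos hs hc
      nlinarith [mul_nonneg h2 h2, mul_nonneg this.le (mul_nonneg h2 h2)]
    · apply div_nonneg _ hn.le
      simp [-Complex.ofReal_sinh, -Complex.ofReal_cosh, translation, h1]
      nlinarith

/-- The identity is excluded from the open half-space, but it is a limit of translations whose
attracting fixed point is `1`. -/
theorem one_mem_closedHalfSpace : (1 : G0) ∈ closedHalfSpace axis rightHalf := by
  refine mem_closure_of_tendsto tendsto_translation ?_
  filter_upwards [self_mem_nhdsWithin] with ε hε
  have hs := Real.sinh_pos_iff.mpr hε
  refine ⟨fun h => ?_, ((1 : ℂ) : OnePoint ℂ), coe_mem_bar_rightHalf_sdiff.mpr (by simp), ?_⟩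
  · rw [← map_one G0.mk, mk_eq_mk_iff] at h
    rcases h with h | h <;>
    · have := congrArg (fun A : SL(2, ℝ) => A 0 1) h
      simp [translation] at this
      exact hs.ne' (Real.sinh_eq_zero.mpr this)
  · rw [isNonrepellingFixed_coe_iff _ _ (by simp)]
    simp only [translation, ofEntries_00, ofEntries_01, ofEntries_10, ofEntries_11]
    constructor
    · ring
    · rw [mul_one, ← Complex.ofReal_add, Complex.normSq_ofReal, Real.sinh_add_cosh,
        ← Real.exp_add]
      exact Real.one_le_exp (add_nonneg (le_of_lt hε) (le_of_lt hε))

/-- Conjugating `h` by a small translation moves its fixed point off the closed axis to the positive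
side, and the conjugates converge to `h`. -/
theorem crookedPlane_subset_closedHalfSpace :
    crookedPlane axis ⊆ closedHalfSpace axis rightHalf := by
  rintro h ⟨x, hx, hh⟩
  rcases eq_or_ne h 1 with rfl | h1
  · exact one_mem_closedHalfSpace
  have hlim : Tendsto (fun ε => mk (translation ε) * h * (mk (translation ε))⁻¹) (𝓝[>] 0)
      (𝓝 (1 * h * 1⁻¹)) :=
    (tendsto_translation.mul_const h).mul tendsto_translation.inv
  rw [one_mul, inv_one, mul_one] at hlim
  refine mem_closure_of_tendsto hlim ?_
  filter_upwards [self_mem_nhdsWithin] with ε hε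
  exact ⟨by simpa using h1, _, translation_smul_mem hε hx, (isNonrepellingFixed_conj_iff _).mpr hh⟩

theorem mem_closedHalfSpace_of_fixed {h : G0} {z : UpperHalfPlane} (hz : z ∈ rightHalf)
    (hh : h • z = z) : h ∈ closedHalfSpace axis rightHalf := by
  rcases eq_or_ne h 1 with rfl | h1
  · exact one_mem_closedHalfSpace
  · exact subset_closure ⟨h1, _, coe_mem_bar_rightHalf_sdiff.mpr ⟨hz, z.im_pos.le⟩,
      isNonrepellingFixed_toSphere hh⟩

/-! ### Elements of the closed half-space fix nonnegative forms -/

theorem FixesForm.smul {h : G0} {p u q : ℝ} (hh : FixesForm h p u q) (c : ℝ) :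
    FixesForm h (c * p) (c * u) (c * q) := by
  obtain ⟨A, hA, κ, hκ, e⟩ := hh
  have : symMatrix (c * p) (c * u) (c * q) = c • symMatrix p u q := by
    ext i j
    fin_cases i <;> fin_cases j <;> simp [symMatrix]
  refine ⟨A, hA, κ, hκ, ?_⟩
  rw [this, Matrix.mul_smul, Matrix.smul_mul, e, smul_comm]

/-- For a matrix of trace 1 the factor is recovered as a trace, which makes the condition visibly
closed in `A` and the form. -/
theorem fixesForm_mk_iff {A : SL(2, ℝ)} {p u q : ℝ} (h : p + q = 1) :
    FixesForm (mk A) p u q ↔ 1 ≤ (A.1 * symMatrix p u q * A.1.transpose).trace ∧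
      A.1 * symMatrix p u q * A.1.transpose =
        (A.1 * symMatrix p u q * A.1.transpose).trace • symMatrix p u q := by
  constructor
  · rintro ⟨B, hB, κ, hκ, e⟩
    have e' : A.1 * symMatrix p u q * A.1.transpose = κ • symMatrix p u q := by
      rcases mk_eq_mk_iff.mp hB with rfl | rfl
      · exact e
      · rw [← e]; simp
    have ht : (κ • symMatrix p u q).trace = κ := by
      rw [Matrix.trace_smul, Matrix.trace_fin_two]
      simp [symMatrix, h]
    rw [e', ht]
    exact ⟨hκ, rfl⟩
  · rintro ⟨h1, h2⟩
    exact ⟨A, rfl, _, h1, h2⟩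

/-- Normalized triples of nonnegative entries of symmetric matrices. -/
def simplexTriples : Set (ℝ × ℝ × ℝ) :=
  (Set.Icc 0 1 ×ˢ Set.Icc 0 1 ×ˢ Set.Icc 0 1) ∩ {x | x.1 + x.2.2 = 1}

theorem isCompact_simplexTriples : IsCompact simplexTriples :=
  (isCompact_Icc.prod (isCompact_Icc.prod isCompact_Icc)).inter_right
    (isClosed_eq (by fun_prop) (by fun_prop))

/-- Normalized forms range over a compact set, and projection along a compact factor is closed. A
limit of elements of the half-space thus still fixes a form, even if their fixed points escape to
`∞`. -/
theorem isClosed_fixesForm :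
    IsClosed {h : G0 | ∃ x ∈ simplexTriples, FixesForm h x.1 x.2.1 x.2.2} := by
  rw [← isOpenQuotientMap_mk.isQuotientMap.isClosed_preimage]
  have hcomp : CompactSpace simplexTriples := isCompact_iff_compactSpace.mp isCompact_simplexTriples
  have hsym : Continuous fun y : SL(2, ℝ) × simplexTriples =>
      symMatrix y.2.1.1 y.2.1.2.1 y.2.1.2.2 := by
    refine continuous_matrix fun i j => ?_
    fin_cases i <;> fin_cases j <;> simp [symMatrix] <;> fun_prop
  have hA : Continuous fun y : SL(2, ℝ) × simplexTriples => y.1.1 :=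
    continuous_subtype_val.comp continuous_fst
  have hX := (hA.matrix_mul hsym).matrix_mul hA.matrix_transpose
  have hcl : IsClosed {y : SL(2, ℝ) × simplexTriples |
      1 ≤ (y.1.1 * symMatrix y.2.1.1 y.2.1.2.1 y.2.1.2.2 * y.1.1.transpose).trace ∧
      y.1.1 * symMatrix y.2.1.1 y.2.1.2.1 y.2.1.2.2 * y.1.1.transpose =
      (y.1.1 * symMatrix y.2.1.1 y.2.1.2.1 y.2.1.2.2 * y.1.1.transpose).trace •
        symMatrix y.2.1.1 y.2.1.2.1 y.2.1.2.2} :=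
    (isClosed_le continuous_const hX.matrix_trace).inter
      (isClosed_eq hX (hX.matrix_trace.smul hsym))
  convert isClosedMap_fst_of_compactSpace _ hcl using 1
  ext A
  constructor
  · rintro ⟨x, hx, hF⟩
    exact ⟨(A, ⟨x, hx⟩), (fixesForm_mk_iff hx.2).mp hF, rfl⟩
  · rintro ⟨⟨A, x⟩, hF, rfl⟩
    exact ⟨x, x.2, (fixesForm_mk_iff x.2.2).mpr hF⟩

theorem exists_fixesForm_of_mem_closedHalfSpace {h : G0}
    (hh : h ∈ closedHalfSpace axis rightHalf) :
    ∃ p u q : ℝ, 0 ≤ p ∧ 0 ≤ u ∧ 0 ≤ q ∧ p + q = 1 ∧ FixesForm h p u q := by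
  have key : closedHalfSpace axis rightHalf ⊆
      {h : G0 | ∃ x ∈ simplexTriples, FixesForm h x.1 x.2.1 x.2.2} := by
    refine closure_minimal ?_ isClosed_fixesForm
    rintro h ⟨-, x, hx, hF⟩
    induction x using OnePoint.rec with
    | infty => exact absurd infty_mem_bar_axis hx.2
    | coe z =>
      obtain ⟨h1, h2⟩ := coe_mem_bar_rightHalf_sdiff.mp hx
      have hn := Complex.normSq_nonneg z
      -- Dividing by the trace `1 + |z|²` normalizes the form; this bound keeps its off-diagonal
      -- entry in the unit interval.
      have hre : z.re ≤ 1 + Complex.normSq z := by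
        rw [Complex.normSq_apply]
        nlinarith [sq_nonneg (z.re - 1), sq_nonneg z.im]
      have hpos : 0 < 1 + Complex.normSq z := by linarith
      have := (fixesForm_coe h2 hF).smul (1 + Complex.normSq z)⁻¹
      refine ⟨(_, _, _), ⟨⟨⟨?_, ?_⟩, ⟨?_, ?_⟩, ?_, ?_⟩, ?_⟩, this⟩
      · positivity
      · simp only [inv_mul_le_iff₀ hpos]; linarith
      · simp only; positivity
      · simp only [inv_mul_le_iff₀ hpos]; linarith
      · simp only; positivity
      · simp only [inv_mul_le_iff₀ hpos]; linarith
      · simp only [Set.mem_ofPred_eq]; field_simp; ring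
  obtain ⟨x, ⟨⟨h1, h2, h3⟩, h4⟩, hF⟩ := key hh
  exact ⟨_, _, _, h1.1, h2.1, h3.1, h4, hF⟩

/-! ### Disjointness of closed half-spaces -/

/-- Testing at the points `r (1 + i)` gives `2 a c r + b d / r + (a d + b c) ≤ 0` for all `r > 0`;
large `r` and small `r` give the two signs. -/
theorem entries_of_re_nonpos {B : SL(2, ℝ)}
    (h : ∀ z ∈ rightHalf, (mk B • z : UpperHalfPlane).re ≤ 0) :
    B 0 0 * B 1 0 ≤ 0 ∧ B 0 1 * B 1 1 ≤ 0 := by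
  have key : ∀ r : ℝ, 0 < r → 2 * (B 0 0 * B 1 0) * r + B 0 1 * B 1 1 / r +
      (B 0 0 * B 1 1 + B 0 1 * B 1 0) ≤ 0 := by
    intro r hr
    have h1 := h (UpperHalfPlane.mk ⟨r, r⟩ hr) hr
    rw [re_mk_smul] at h1
    have h2 := not_lt.mp fun hlt => absurd h1 (not_le.mpr
      (div_pos hlt (Complex.normSq_pos.mpr (denom_ne_zero B _))))
    have h3 : B 0 0 * B 1 0 * (r * r + r * r) + B 0 1 * B 1 1 +
      (B 0 0 * B 1 1 + B 0 1 * B 1 0) * r ≤ 0 := by simpa [Complex.normSq_apply] using h2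
    have e : 2 * (B 0 0 * B 1 0) * r + B 0 1 * B 1 1 / r + (B 0 0 * B 1 1 + B 0 1 * B 1 0) =
      (B 0 0 * B 1 0 * (r * r + r * r) + B 0 1 * B 1 1 +
      (B 0 0 * B 1 1 + B 0 1 * B 1 0) * r) / r := by
      field_simp
      ring
    rw [e]
    exact div_nonpos_of_nonpos_of_nonneg h3 hr.le
  constructor
  · by_contra! hlt
    obtain ⟨r, hr, hpos⟩ := exists_pos_of_leading_pos (mul_pos two_pos hlt) (B 0 1 * B 1 1)
      (B 0 0 * B 1 1 + B 0 1 * B 1 0)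
    exact absurd (key r hr) (not_le.mpr hpos)
  · by_contra! hlt
    obtain ⟨r, hr, hpos⟩ := exists_pos_of_leading_pos hlt (2 * (B 0 0 * B 1 0))
      (B 0 0 * B 1 1 + B 0 1 * B 1 0)
    have := key r⁻¹ (inv_pos.mpr hr)
    simp only [div_eq_mul_inv, inv_inv] at this hpos
    linarith

theorem disjoint_smul_rightHalf_iff {b : G0} :
    Disjoint (b • rightHalf) rightHalf ↔ ∀ z ∈ rightHalf, (b • z : UpperHalfPlane).re ≤ 0 := by
  rw [Set.disjoint_left]
  constructor
  · exact fun H z hz => not_lt.mp (H (Set.smul_mem_smul_set hz))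
  · rintro H _ ⟨z, hz, rfl⟩
    exact not_lt.mpr (H z hz)

theorem _root_.HypPlane.Dominates.ne_of_mem_closedHalfSpace {B₁ B₀ : SL(2, ℝ)}
    (hD : Dominates B₁ B₀) (hdisj : Disjoint (mk B₁ • rightHalf) rightHalf) {h h' : G0}
    (hh : h ∈ closedHalfSpace axis rightHalf) (hh' : h' ∈ closedHalfSpace axis rightHalf) :
    mk B₁ * h ≠ h' * mk B₀ := by
  obtain ⟨p, u, q, hp, hu, hq, hpq, hF⟩ := exists_fixesForm_of_mem_closedHalfSpace hh
  obtain ⟨p', u', q', hp', hu', hq', hpq', hF'⟩ := exists_fixesForm_of_mem_closedHalfSpace hh'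
  refine hD.not_intertwined_forms hF hF' hp hq (by linarith) hp' hq' (by linarith) ?_
  have hne : ∀ i j, B₁ i j ≠ 0 := fun i j => abs_pos.mp ((abs_nonneg _).trans_lt (hD i j))
  obtain ⟨hac, hbd⟩ := entries_of_re_nonpos (disjoint_smul_rightHalf_iff.mp hdisj)
  -- The same sign lemma for the inverse matrix controls `a b` and `c d`. All cross terms of `B₁`
  -- then contribute nonnegatively, so each bounds the absolute value of its counterpart for `B₀`.
  have hdisj' : Disjoint (mk B₁⁻¹ • rightHalf) rightHalf := by
    have := (Set.disjoint_image_iff (MulAction.injective (mk B₁⁻¹))).mpr hdisj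
    rw [Set.image_smul, Set.image_smul, ← mul_smul, ← map_mul, inv_mul_cancel, map_one,
      one_smul] at this
    exact this.symm
  obtain ⟨hcd, hab⟩ := entries_of_re_nonpos (disjoint_smul_rightHalf_iff.mp hdisj')
  simp only [inv_entry_00, inv_entry_01, inv_entry_10, inv_entry_11] at hcd hab
  have hab' : 0 < B₁ 0 0 * B₁ 0 1 :=
    lt_of_le_of_ne (by linarith) (mul_ne_zero (hne _ _) (hne _ _)).symm
  have hcd' : 0 < B₁ 1 0 * B₁ 1 1 :=
    lt_of_le_of_ne (by linarith) (mul_ne_zero (hne _ _) (hne _ _)).symm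
  have had : B₁ 0 0 * B₁ 1 1 ≤ 0 := by
    have h1 : B₁ 1 0 ^ 2 * (B₁ 0 0 * B₁ 1 1) ≤ 0 := by
      rw [show B₁ 1 0 ^ 2 * (B₁ 0 0 * B₁ 1 1) = (B₁ 0 0 * B₁ 1 0) * (B₁ 1 0 * B₁ 1 1) by ring]
      exact mul_nonpos_of_nonpos_of_nonneg hac hcd'.le
    exact nonpos_of_mul_nonpos_right h1 (sq_pos_of_ne_zero (hne 1 0))
  have hbc : B₁ 0 1 * B₁ 1 0 ≤ 0 := by
    have h1 : B₁ 0 0 ^ 2 * (B₁ 0 1 * B₁ 1 0) ≤ 0 := by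
      rw [show B₁ 0 0 ^ 2 * (B₁ 0 1 * B₁ 1 0) = (B₁ 0 0 * B₁ 1 0) * (B₁ 0 0 * B₁ 0 1) by ring]
      exact mul_nonpos_of_nonpos_of_nonneg hac hab'.le
    exact nonpos_of_mul_nonpos_right h1 (sq_pos_of_ne_zero (hne 0 0))
  have hmul : ∀ i j k l, |B₀ i j * B₀ k l| ≤ |B₁ i j * B₁ k l| := by
    intro i j k l
    rw [abs_mul, abs_mul]
    exact mul_le_mul (hD i j).le (hD k l).le (abs_nonneg _) (abs_nonneg _)
  have m1 := hmul 0 0 0 1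
  have m2 := hmul 1 0 1 1
  have m3 := hmul 0 0 1 0
  have m4 := hmul 0 1 1 1
  have m5 := hmul 0 0 1 1
  have m6 := hmul 0 1 1 0
  rw [abs_of_pos hab'] at m1
  rw [abs_of_pos hcd'] at m2
  rw [abs_of_nonpos hac] at m3
  rw [abs_of_nonpos hbd] at m4
  rw [abs_of_nonpos had] at m5
  rw [abs_of_nonpos hbc] at m6
  have t1 : |q' * (B₀ 0 0 * B₀ 0 1) + p' * (B₀ 1 0 * B₀ 1 1)| ≤
      q' * (B₁ 0 0 * B₁ 0 1) + p' * (B₁ 1 0 * B₁ 1 1) := by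
    refine (abs_add_le _ _).trans ?_
    rw [abs_mul q', abs_mul p', abs_of_nonneg hp', abs_of_nonneg hq']
    gcongr
  have t2 : |p * (B₀ 0 0 * B₀ 1 0) + q * (B₀ 0 1 * B₀ 1 1)| ≤
      -(p * (B₁ 0 0 * B₁ 1 0) + q * (B₁ 0 1 * B₁ 1 1)) := by
    refine (abs_add_le _ _).trans ?_
    rw [abs_mul p, abs_mul q, abs_of_nonneg hp, abs_of_nonneg hq]
    linarith [mul_le_mul_of_nonneg_left m3 hp, mul_le_mul_of_nonneg_left m4 hq]
  have t3 : |B₀ 0 0 * B₀ 1 1 + B₀ 0 1 * B₀ 1 0| ≤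
      -(B₁ 0 0 * B₁ 1 1 + B₁ 0 1 * B₁ 1 0) := by
    refine (abs_add_le _ _).trans ?_
    linarith
  refine (abs_sub _ _).trans ?_
  refine (add_le_add_left (abs_sub _ _) _).trans ?_
  rw [abs_mul, abs_mul (2 * u'), abs_mul (2 * u * u'), abs_of_nonneg (show 0 ≤ 2 * u by positivity),
    abs_of_nonneg (show 0 ≤ 2 * u' by positivity), abs_of_nonneg (show 0 ≤ 2 * u * u' by positivity)]
  have s1 := mul_le_mul_of_nonneg_left t1 (show 0 ≤ 2 * u by positivity)
  have s2 := mul_le_mul_of_nonneg_left t2 (show 0 ≤ 2 * u' by positivity)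
  have s3 := mul_le_mul_of_nonneg_left t3 (show 0 ≤ 2 * u * u' by positivity)
  linarith

theorem continuous_smul_dist (b : G0) :
    Continuous fun p : UpperHalfPlane × UpperHalfPlane => dist (b • p.1) p.2 :=
  (continuous_fst.const_smul b).dist continuous_snd

/-- A strict inequality at the point `i` of the axis persists after a small horizontal shift into
the open half-plane. -/
theorem exists_mem_rightHalf_dist_lt {b₁ b₀ : G0}
    (h : dist (b₀ • UpperHalfPlane.I) UpperHalfPlane.I <
      dist (b₁ • UpperHalfPlane.I) UpperHalfPlane.I) :
    ∃ p ∈ rightHalf ×ˢ rightHalf, dist (b₀ • p.1) p.2 < dist (b₁ • p.1) p.2 := by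
  have hcont : Continuous fun ε : ℝ => ε +ᵥ UpperHalfPlane.I := by
    rw [UpperHalfPlane.isOpenEmbedding_coe.isInducing.continuous_iff]
    simp only [Function.comp_def, UpperHalfPlane.coe_vadd]
    fun_prop
  have h1 : Tendsto (fun ε : ℝ => (ε +ᵥ UpperHalfPlane.I, ε +ᵥ UpperHalfPlane.I)) (𝓝[>] 0)
      (𝓝 (UpperHalfPlane.I, UpperHalfPlane.I)) := by
    have := (hcont.prodMk hcont).tendsto 0
    rw [zero_vadd] at this
    exact tendsto_nhdsWithin_of_tendsto_nhds this
  have h2 := (continuous_smul_dist b₀).continuousAt.eventually_lt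
    (continuous_smul_dist b₁).continuousAt
    (show dist (b₀ • (UpperHalfPlane.I, UpperHalfPlane.I).1) (UpperHalfPlane.I, UpperHalfPlane.I).2 <
      dist (b₁ • (UpperHalfPlane.I, UpperHalfPlane.I).1) (UpperHalfPlane.I, UpperHalfPlane.I).2 from h)
  obtain ⟨ε, hε, hpos⟩ := ((h1.eventually h2).and self_mem_nhdsWithin).exists
  have hmem : ε +ᵥ UpperHalfPlane.I ∈ rightHalf := by
    change 0 < (ε +ᵥ UpperHalfPlane.I).re
    simpa using hpos
  exact ⟨_, ⟨hmem, hmem⟩, hε⟩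

/-- If `z` and `B₁ z` are both on the positive side, the `B₁`-distance for the pair `(z, B₁ z)` is
0, hence at most the `B₀`-distance, while near `(i, i)` it is larger. By connectedness the two agree
somewhere, and rotations about that pair of points contradict `H`. -/
theorem _root_.HypPlane.Dominates.disjoint_rightHalf {B₁ B₀ : SL(2, ℝ)} (hD : Dominates B₁ B₀)
    (H : ∀ h ∈ closedHalfSpace axis rightHalf, ∀ h' ∈ closedHalfSpace axis rightHalf,
      mk B₁ * h ≠ h' * mk B₀) : Disjoint (mk B₁ • rightHalf) rightHalf := by
  rw [Set.disjoint_left]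
  rintro _ ⟨z, hz, rfl⟩ hz'
  have hI : UpperHalfPlane.I ∈ axis := by rw [← axisPt_zero]; exact axisPt_re 0
  obtain ⟨p, hp, hlt⟩ := exists_mem_rightHalf_dist_lt (hD.lt_dist hI hI)
  obtain ⟨r, hr, hr0⟩ := (isPreconnected_rightHalf.prod isPreconnected_rightHalf).intermediate_value
    (show (z, mk B₁ • z) ∈ rightHalf ×ˢ rightHalf from ⟨hz, hz'⟩) hp
    ((continuous_smul_dist (mk B₁)).sub (continuous_smul_dist (mk B₀))).continuousOn
    (show (0 : ℝ) ∈ Set.Icc _ _ from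
      ⟨by simp, by simp only [Pi.sub_apply]; linarith⟩)
  obtain ⟨h, h', hx, hy, e⟩ := exists_fixed_intertwined (sub_eq_zero.mp hr0)
  exact H h (mem_closedHalfSpace_of_fixed hr.1 hx) h' (mem_closedHalfSpace_of_fixed hr.2 hy) e

theorem forall_closedHalfSpace_ne_iff (B₁ B₀ : SL(2, ℝ)) :
    (∀ h ∈ closedHalfSpace axis rightHalf, ∀ h' ∈ closedHalfSpace axis rightHalf,
      mk B₁ * h ≠ h' * mk B₀) ↔ Dominates B₁ B₀ ∧ Disjoint (mk B₁ • rightHalf) rightHalf := by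
  constructor
  · intro H
    have hD : Dominates B₁ B₀ := dominates_of_not_intertwined (by
      rintro ⟨h, hh, h', hh', e⟩
      exact H h (crookedPlane_subset_closedHalfSpace hh) h'
        (crookedPlane_subset_closedHalfSpace hh') e)
    exact ⟨hD, hD.disjoint_rightHalf H⟩
  · rintro ⟨hD, hdisj⟩ h hh h' hh'
    exact hD.ne_of_mem_closedHalfSpace hdisj hh hh'

theorem disjoint_closedHalfSpace_iff (G G' K K' : SL(2, ℝ)) :
    Disjoint (mk G • closedHalfSpace (mk K • axis) (mk K • rightHalf))
      (mk G' • closedHalfSpace (mk K' • axis) (mk K' • rightHalf)) ↔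
    Dominates ((G' * K')⁻¹ * (G * K)) (K'⁻¹ * K) ∧
      Disjoint (mk G • mk K • rightHalf) (mk G' • mk K' • rightHalf) := by
  rw [disjoint_smul_iff (closedHalfSpace_smul (mk K) axis rightHalf)
    (closedHalfSpace_smul (mk K') axis rightHalf)]
  have e : Disjoint (mk G • mk K • rightHalf) (mk G' • mk K' • rightHalf) ↔
      Disjoint (mk ((G' * K')⁻¹ * (G * K)) • rightHalf) rightHalf := by
    rw [← Set.disjoint_image_iff (t := rightHalf) (MulAction.injective (mk (G' * K'))),
      Set.image_smul, Set.image_smul, ← mul_smul (mk (G' * K')) (mk ((G' * K')⁻¹ * (G * K))),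
      ← map_mul, mul_inv_cancel_left, map_mul, map_mul, mul_smul, mul_smul]
  rw [e, ← forall_closedHalfSpace_ne_iff]
  simp only [map_mul, map_inv]

end AdS

theorem theorem3p1
    (l l' : Set UpperHalfPlane)
    (hl : HypPlane.IsGeodesicLine l) (hl' : HypPlane.IsGeodesicLine l')
    (g g' : G0) :
    -- the three conditions are equivalent
    [ Disjoint (g • AdS.crookedPlane l) (g' • AdS.crookedPlane l'),
      ∃ K : ℝ, 0 < K ∧ ∀ x ∈ l, ∀ x' ∈ l', K ≤ dist (g • x) (g' • x') - dist x x',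
      ∀ ξ ∈ HypPlane.endpoints l, ∀ ξ' ∈ HypPlane.endpoints l',
        g • ξ ≠ g' • ξ' ∧ ∃ L : EReal, HypPlane.ExtDistDiff g g' ξ ξ' L ∧ 0 < L ].TFAE ∧
    -- they imply that the image lines have disjoint closures
    (Disjoint (g • AdS.crookedPlane l) (g' • AdS.crookedPlane l') →
      Disjoint (HypPlane.bar (g • l)) (HypPlane.bar (g' • l'))) ∧
    -- half-spaces, for all transverse orientations
    ∀ P P' : Set UpperHalfPlane, HypPlane.IsSide l P → HypPlane.IsSide l' P' →
      (fun h => h * g) '' AdS.closedHalfSpace (g • l) (g • P) = g • AdS.closedHalfSpace l P ∧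
      (fun h => h * g') '' AdS.closedHalfSpace (g' • l') (g' • P') =
        g' • AdS.closedHalfSpace l' P' ∧
      (Disjoint (g • AdS.closedHalfSpace l P) (g' • AdS.closedHalfSpace l' P') ↔
        Disjoint (g • AdS.crookedPlane l) (g' • AdS.crookedPlane l') ∧
        Disjoint (g • P) (g' • P')) := by
  obtain ⟨k, hk⟩ := hl.exists_eq_smul_axis
  obtain ⟨k', hk'⟩ := hl'.exists_eq_smul_axis
  obtain ⟨G, rfl⟩ := G0.mk_surjective g
  obtain ⟨G', rfl⟩ := G0.mk_surjective g'
  obtain ⟨K, rfl⟩ := G0.mk_surjective k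
  obtain ⟨K', rfl⟩ := G0.mk_surjective k'
  refine ⟨?_, ?_, ?_⟩
  · rw [hk, hk', AdS.disjoint_crookedPlane_iff, AdS.uniform_gap_iff_dominates,
      HypPlane.endpoint_conditions_iff_dominates]
    tfae_finish
  · rw [hk, hk', AdS.disjoint_crookedPlane_iff]
    exact AdS.disjoint_bar_of_dominates G G' K K'
  · intro P P' hP hP'
    refine ⟨AdS.image_mul_right_closedHalfSpace_smul _ _ _,
      AdS.image_mul_right_closedHalfSpace_smul _ _ _, ?_⟩
    -- The chosen side may require another normalizing isometry than `k`; the crooked plane depends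
    -- only on the line, so it is rewritten with the new one.
    obtain ⟨κ, hκ, rfl⟩ := hP.exists_eq_smul hl
    obtain ⟨κ', hκ', rfl⟩ := hP'.exists_eq_smul hl'
    obtain ⟨M, rfl⟩ := G0.mk_surjective κ
    obtain ⟨M', rfl⟩ := G0.mk_surjective κ'
    rw [hκ, hκ', AdS.disjoint_closedHalfSpace_iff, AdS.disjoint_crookedPlane_iff]
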